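/- **Model.** Fix an integer $\tau\ge 2$ (number of classes). Each of $\ell$ objects has a class $T_i\in[\tau]$; the labels are i.i.d. with an unknown distribution $P_T$ on $[\tau]$. Responses take values in $\mathcal Y=[\tau]\cup\{\xi\}$, where $\xi$ is a null response. For a label vector $t\in[\tau]^\ell$ let $\tilde\imath=\max\{k<i:t_k=t_i\}$ (when it exists) and $\mathcal N_i=\{i-1\}\cup\{\tilde\imath\}$, omitting indices that do not exist. A *worker* is given by a Markov memory kernel $Q(\cdot\mid y_{i-1},y_{\tilde\imath},t_i)$, with an argument left blank when the corresponding neighbour does not exist. The worker's responses have law $\Pr(Y^\ell=y^\ell\mid T^\ell=t^\ell)=\prod_{i}Q(y_i\mid y_{i-1},y_{\tilde\imath},t_i)$. The marginals are required to satisfy $\Pr(Y_i=y\mid T^\ell=t^\ell)=Q(y\mid t_i)$ for all $t^\ell$ and $i$. A *pool* is a finite set of workers with a probability distribution on it; $n$ workers are drawn independently from it, and given $T^\ell$ they answer all objects independently of one another. Let $Q_t(y)$ be the pool average of $Q(y\mid t)$, and let mutual informations (in bits) be those of a random worker of the pool given $T^\ell=t^\ell$. The *distance quality* of the pool is $\theta_d=\min_{s\ne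 t}\sum_y|Q_s(y)-Q_t(y)|$. Its *memory quality* is $$\theta_m=\tfrac12\Bigl(\min I(Y_i;Y_{\mathcal N_i})-\max_{j<i,\ j\notin\mathcal N_i} I(Y_i;Y_{i-1},Y_j)\Bigr),$$ where the minimum is over all label vectors and all $i$ for which $\tilde\imath$ exists, and the maximum is over all label vectors, those $i$ for which $\tilde\imath$ exists and $\tilde\imath\neq i-1$, and all such $j$ (it is $0$ if there are none). A decoder for $n$ responses per object maps the matrix $(Y_{i,j})_{i\le\ell,\,j\le n}$ to a partition of $[\ell]$. Its error probability $P_e$ is the probability that the output is not the partition of $[\ell]$ into objects of equal label. The sample complexity $N_u^*=N^*_u(\epsilon;\tau,\ell,\theta_m,\theta_d)\in\mathbb N\cup\{\infty\}$ is the least $n$ for which a single decoder has $P_e<\epsilon$ for every $P_T$ and every pool of memory quality $\theta_m$ and distance quality $\theta_d$. Call a pool *$\kappa$-noisy* if there are two classes $a\ne b$ such that each worker of the pool has a set $S\subseteq\mathcal Y$ with the following property: for every choice of neighbours' responses in $S$ (or blank), the response to an object of class $a$ or $b$ lies in $S$ and takes each value in $S$ with conditional probability at least $\kappa$. Call $(\theta_m,\theta_d)$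 *non-degenerate* if for some $\kappa>0$ and all sufficiently large $\ell$ there is a $\kappa$-noisy pool with exactly these qualities. **Theorem.** Let $\tau\ge2$ and $0<\epsilon\le\frac14$. 1. For every fixed non-degenerate pair $(\theta_m,\theta_d)$, $N_u^*=\Omega(\log\ell)$: there are $c>0$ and $L$ with $N_u^*\ge c\log\ell$ for all $\ell\ge L$. 2. For every fixed $\ell\ge 2$, $N_u^*=\Omega\bigl((\theta_m+\theta_d^2)^{-1}\bigr)$: there is $c>0$ such that $N_u^*\ge c\,(\theta_m+\theta_d^2)^{-1}$ for all $\theta_m,\theta_d\ge0$ that are the qualities of some pool (with $N_u^*=\infty$ if $\theta_m=\theta_d=0$). 3. For every $d<2$ there are $m>0$ and $\kappa>0$ such that every pair with $0\le\theta_m\le m$ and $0\le\theta_d\le d$ is, for every $\ell\ge2$, the pair of qualities of some $\kappa$-noisy pool. In particular, all these pairs are non-degenerate. -/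

import Mathlib

open Finset
open scoped BigOperators ENNReal

noncomputable section

namespace CrowdClustering

/-- A worker's answer to a task: a class in `[τ]`, or the null response `none`. -/
abbrev Response (τ : ℕ) : Type := Option (Fin τ)

/-! ### Neighbours of an object -/

/-- The largest element of a finite set of objects, `none` if the set is empty. -/
def latest {ℓ : ℕ} (s : Finset (Fin ℓ)) : Option (Fin ℓ) :=
  if h : s.Nonempty then some (s.max' h) else none

/-- The object presented just before object `i`; `none` for the first object. -/
def prevIdx {ℓ : ℕ} (i : Fin ℓ) : Option (Fin ℓ) :=
  latest (univ.filter fun k => k < i)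

/-- The most recent earlier object of the same class as `i`; `none` if there is none. -/
def sameIdx {τ ℓ : ℕ} (t : Fin ℓ → Fin τ) (i : Fin ℓ) : Option (Fin ℓ) :=
  latest (univ.filter fun k => k < i ∧ t k = t i)

/-- The set of neighbours of object `i`: the most recent object and the most recent object of
the same class. -/
def nbr {τ ℓ : ℕ} (t : Fin ℓ → Fin τ) (i : Fin ℓ) : Finset (Fin ℓ) :=
  (prevIdx i).toFinset ∪ (sameIdx t i).toFinset

/-! ### Workers with Markov memory and fixed conditional marginals -/

/-- The law of the responses `y` of one worker to the objects with labels `t`: the response to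
object `i` is drawn from `K (response to the previous object) (response to the most recent object
of the same class) (class of i)`, an argument being `none` when that neighbour does not exist. -/
def markovLaw {τ ℓ : ℕ}
    (K : Option (Response τ) → Option (Response τ) → Fin τ → Response τ → ℝ)
    (t : Fin ℓ → Fin τ) (y : Fin ℓ → Response τ) : ℝ :=
  ∏ i, K ((prevIdx i).map y) ((sameIdx t i).map y) (t i) (y i)

/-- A worker of the unified model: a Markov memory kernel, together with the conditional
distributions `marg t = Q(· | t)` of a single response, which must be the marginals of the
response law at every object, whatever the labels of the other objects. -/
structure Worker (τ ℓ : ℕ) where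
  kernel : Option (Response τ) → Option (Response τ) → Fin τ → Response τ → ℝ
  kernel_mem : ∀ p s t, kernel p s t ∈ stdSimplex ℝ (Response τ)
  marg : Fin τ → Response τ → ℝ
  marg_mem : ∀ t, marg t ∈ stdSimplex ℝ (Response τ)
  marginal : ∀ (t : Fin ℓ → Fin τ) (i : Fin ℓ) (a : Response τ),
    ∑ y ∈ univ.filter (fun y : Fin ℓ → Response τ => y i = a), markovLaw kernel t y
      = marg (t i) a

/-- A pool of workers: a finite crowd with the distribution from which workers are drawn. -/
structure WorkerPool (τ ℓ : ℕ) where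
  size : ℕ
  worker : Fin size → Worker τ ℓ
  weight : Fin size → ℝ
  weight_mem : weight ∈ stdSimplex ℝ (Fin size)

namespace WorkerPool

variable {τ ℓ : ℕ}

/-- The law of the responses of a worker drawn at random from the pool, given the labels `t`. -/
def law (R : WorkerPool τ ℓ) (t : Fin ℓ → Fin τ) (y : Fin ℓ → Response τ) : ℝ :=
  ∑ w, R.weight w * markovLaw (R.worker w).kernel t y

/-- The conditional response distribution `Q_t` of a random worker to an object of class `t`. -/
def resp (R : WorkerPool τ ℓ) (t : Fin τ) (a : Response τ) : ℝ :=
  ∑ w, R.weight w * (R.worker w).marg t a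

end WorkerPool

/-! ### Information and distance -/

open Classical in
/-- The probability mass function of `X` when the sample point has mass function `p`. -/
def massOf {Ω α : Type} [Fintype Ω] (p : Ω → ℝ) (X : Ω → α) (a : α) : ℝ :=
  ∑ ω ∈ univ.filter (fun ω => X ω = a), p ω

/-- The mutual information (in bits) of `X` and `Z` under `p`. -/
def mutualInfo {Ω α β : Type} [Fintype Ω] [Fintype α] [Fintype β]
    (p : Ω → ℝ) (X : Ω → α) (Z : Ω → β) : ℝ :=
  ∑ a, ∑ b, massOf p (fun ω => (X ω, Z ω)) (a, b) *
    Real.logb 2 (massOf p (fun ω => (X ω, Z ω)) (a, b) / (massOf p X a * massOf p Z b))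

/-- The total variational distance `δ(p, q) = ∑ |p - q|`. -/
def tvDist {α : Type} [Fintype α] (p q : α → ℝ) : ℝ := ∑ a, |p a - q a|

namespace WorkerPool

variable {τ ℓ : ℕ}

/-- `I(Y_i ; Y_S)` for a random worker of the pool, given the labels `t`. -/
def info (R : WorkerPool τ ℓ) (t : Fin ℓ → Fin τ) (i : Fin ℓ) (S : Finset (Fin ℓ)) : ℝ :=
  mutualInfo (R.law t) (fun y => y i) (fun y (j : S) => y j)

/-- Distance quality: `min_{s ≠ t} δ(Q_s, Q_t)`. -/
def distQuality (R : WorkerPool τ ℓ) : ℝ :=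
  sInf {d | ∃ s t : Fin τ, s ≠ t ∧ d = tvDist (R.resp s) (R.resp t)}

/-- Memory quality:
`(min I(Y_i ; Y_{N_i}) - max_{j < i, j ∉ N_i} I(Y_i ; Y_{i-1}, Y_j)) / 2`, over all label vectors.
The minimum runs over the objects that have an earlier object of their class. The maximum runs
over those of them whose most recent object of the same class is not `i - 1` (otherwise
`{i - 1, j}` contains all of `N_i` and there is nothing to compare); it is `0` if there is no
such triple. -/
def memQuality (R : WorkerPool τ ℓ) : ℝ :=
  (sInf {v | ∃ (t : Fin ℓ → Fin τ) (i : Fin ℓ), sameIdx t i ≠ none ∧ v = R.info t i (nbr t i)}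
    - sSup {v | ∃ (t : Fin ℓ → Fin τ) (i j : Fin ℓ), sameIdx t i ≠ none ∧
        sameIdx t i ≠ prevIdx i ∧ j < i ∧ j ∉ nbr t i ∧
        v = R.info t i ((prevIdx i).toFinset ∪ {j})}) / 2

/-- The pool has memory quality `θm` and distance quality `θd`. -/
def HasQuality (R : WorkerPool τ ℓ) (θm θd : ℝ) : Prop :=
  R.memQuality = θm ∧ R.distQuality = θd

/-- There are two classes `a ≠ b` on which the workers are noisy at level `κ`: each worker has a
set `S` of responses such that, given any earlier responses from `S`, the response to an
object of class `a` or `b` lies in `S`, and takes each value of `S` with probability at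
least `κ`. -/
def IsNoisy (R : WorkerPool τ ℓ) (κ : ℝ) : Prop :=
  ∃ a b : Fin τ, a ≠ b ∧ ∀ w, ∃ S : Finset (Response τ),
    ∀ p s : Option (Response τ), (∀ y ∈ p, y ∈ S) → (∀ y ∈ s, y ∈ S) →
      ∀ t, (t = a ∨ t = b) → ∀ y,
        (y ∈ S → κ ≤ (R.worker w).kernel p s t y) ∧
        (y ∉ S → (R.worker w).kernel p s t y = 0)

end WorkerPool

/-! ### Clustering -/

/-- A clustering of `ℓ` objects, a partition of `[ℓ]` given as an equivalence relation. -/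
abbrev Clustering (ℓ : ℕ) : Type := Setoid (Fin ℓ)

/-- The correct clustering: two objects share a cluster iff their labels agree. -/
abbrev correctClustering {τ ℓ : ℕ} (t : Fin ℓ → Fin τ) : Clustering ℓ := Setoid.ker t

/-- A decoder for `n` responses per object: it maps the `ℓ × n` matrix of responses, whose
entry `Y i j` is the response of worker `j` to object `i`, to a clustering. -/
abbrev Decoder (τ ℓ n : ℕ) : Type := (Fin ℓ → Fin n → Response τ) → Clustering ℓ

open Classical in
/-- The error probability of a decoder: labels are i.i.d. with distribution `P`, and given
the labels, the `n` workers are drawn and respond independently of one another. -/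
def errorProb {τ ℓ n : ℕ} (Φ : Decoder τ ℓ n) (P : Fin τ → ℝ) (R : WorkerPool τ ℓ) : ℝ :=
  ∑ t : Fin ℓ → Fin τ, (∏ i, P (t i)) *
    ∑ Y : Fin ℓ → Fin n → Response τ, (∏ j, R.law t (fun i => Y i j)) *
      (if Φ Y ≠ correctClustering t then 1 else 0)

/-- Some decoder, chosen without knowledge of the prior and of the pool, has error probability
below `ε` for every prior and every pool of memory quality `θm` and distance quality `θd`. -/
def Solvable (τ ℓ n : ℕ) (ε θm θd : ℝ) : Prop :=
  ∃ Φ : Decoder τ ℓ n, ∀ P ∈ stdSimplex ℝ (Fin τ), ∀ R : WorkerPool τ ℓ,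
    R.HasQuality θm θd → errorProb Φ P R < ε

/-- The sample complexity `N*_u(ε)` of universal clustering of `ℓ` objects from `τ` classes under
the unified worker model: the least number of responses per object that suffices, `⊤` if none
does. -/
def sampleComplexity (τ ℓ : ℕ) (ε θm θd : ℝ) : ℕ∞ :=
  ⨅ (n : ℕ) (_ : Solvable τ ℓ n ε θm θd), (n : ℕ∞)

/-- The quality pair `(θm, θd)` is non-degenerate: at some fixed noise level `κ > 0` it is the
quality of a noisy pool, for every large number `ℓ` of objects. -/
def NonDegenerate (τ : ℕ) (θm θd : ℝ) : Prop :=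
  ∃ κ : ℝ, 0 < κ ∧ ∃ L : ℕ, ∀ ℓ : ℕ, L ≤ ℓ →
    ∃ R : WorkerPool τ ℓ, R.HasQuality θm θd ∧ R.IsNoisy κ

end CrowdClustering

end

/-!
The third part is a construction. A pool with one worker is used whose answer to an object of class
`t`, given the answer `s` to the most recent object of the same class, has mass
`Q t y * (1 + w t y * u t s)`. Here `Q t` is the uniform distribution tilted towards `t` by
`θd / 2`, which fixes all pairwise distances of the response distributions, and `u`, `w` satisfy
`∑ Q u = ∑ Q w = ∑ Q w u = 0`. The first two relations make `Q t` the marginal; the third one says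
that the square of the transition matrix is the independent coupling, so that an answer carries no
information about any earlier answer but its same-class predecessor
(`StepMemory.sum_markovLaw_mul_prod_eq_zero`). Hence the maximum in the memory quality is `0`, and
the minimum is the information of a single step, which grows continuously and at least
quadratically with the strength of `w` (`le_tiltedInfo`). The intermediate value theorem yields
every small memory quality, whatever the number of objects (`exists_noisy_pool`).

The two lower bounds use the uniform prior on two classes `a`, `b` and the map that flips one label
between them.

For many objects, a flip changes at most three factors of the law of a worker, so for a `κ`-noisy
pool it lowers the likelihood of the responses of `n` workers at most by the factor `κ ^ (3 * n)`
(`pow_three_mul_markovLaw_le`). A correctly decoded label vector therefore competes with its `ℓ`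
flips, all decoded wrongly, and a wrongly decoded vector is the flip of at most one correctly
decoded one. This gives `ℓ * κ ^ (3 * n) * (1 - Pₑ) ≤ Pₑ` (`mul_one_sub_errorProb_le`), which is
incompatible with `Pₑ < 1 / 4` as soon as `ℓ * κ ^ (3 * n) ≥ 1`.

For few objects, the pools of the third part have a law whose density with respect to the uniform
distribution is within a multiple of `√(θm + θd ^ 2)` of `1`. The second moment of the density is
multiplicative over workers (`sq_sum_abs_prod_sub_le`), so with fewer than a small multiple of
`(θm + θd ^ 2)⁻¹` workers the responses are nearly uniform for all label vectors, and decoding is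
hardly better than guessing (`half_sub_le_errorProb`). For qualities that are not small the bound
only says that at least one worker is needed.
-/

namespace CrowdClustering

/-! ### Latest elements and neighbours -/

theorem latest_eq_some_iff {ℓ : ℕ} {s : Finset (Fin ℓ)} {k : Fin ℓ} :
    latest s = some k ↔ k ∈ s ∧ ∀ m ∈ s, m ≤ k := by
  unfold latest
  split_ifs with h
  · rw [Option.some_inj, Finset.max'_eq_iff]
  · rw [Finset.not_nonempty_iff_eq_empty] at h
    simp [h]

theorem latest_eq_none_iff {ℓ : ℕ} {s : Finset (Fin ℓ)} : latest s = none ↔ s = ∅ := by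
  unfold latest
  split_ifs with h
  · simpa using h.ne_empty
  · simpa [Finset.not_nonempty_iff_eq_empty] using h

theorem latest_map_castSucc {ℓ : ℕ} (s : Finset (Fin ℓ)) :
    latest (s.map Fin.castSuccEmb) = (latest s).map Fin.castSucc := by
  cases h : latest s with
  | none => rw [latest_eq_none_iff] at h; simp [h, latest_eq_none_iff]
  | some k =>
    rw [latest_eq_some_iff] at h
    rw [Option.map_some, latest_eq_some_iff]
    refine ⟨by simpa using h.1, fun m hm => ?_⟩
    obtain ⟨m', hm', rfl⟩ := Finset.mem_map.1 hm
    simpa using h.2 m' hm'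

theorem prevIdx_eq_some_iff {ℓ : ℕ} {i k : Fin ℓ} :
    prevIdx i = some k ↔ k < i ∧ ∀ m < i, m ≤ k := by
  simp [prevIdx, latest_eq_some_iff]

theorem sameIdx_eq_some_iff {τ ℓ : ℕ} {t : Fin ℓ → Fin τ} {i k : Fin ℓ} :
    sameIdx t i = some k ↔ (k < i ∧ t k = t i) ∧ ∀ m < i, t m = t i → m ≤ k := by
  simp [sameIdx, latest_eq_some_iff]

theorem prevIdx_castSucc {ℓ : ℕ} (i : Fin ℓ) :
    prevIdx i.castSucc = (prevIdx i).map Fin.castSucc := by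
  rw [prevIdx, prevIdx, ← latest_map_castSucc]
  congr 1
  ext m
  induction m using Fin.lastCases <;> simp [Fin.le_last, (Fin.castSucc_lt_last _).ne]

theorem sameIdx_castSucc {τ ℓ : ℕ} (t : Fin (ℓ + 1) → Fin τ) (i : Fin ℓ) :
    sameIdx t i.castSucc = (sameIdx (fun k => t k.castSucc) i).map Fin.castSucc := by
  rw [sameIdx, sameIdx, ← latest_map_castSucc]
  congr 1
  ext m
  induction m using Fin.lastCases <;> simp [Fin.le_last, (Fin.castSucc_lt_last _).ne]

theorem prevIdx_last {ℓ : ℕ} :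
    prevIdx (Fin.last ℓ) = (latest univ).map Fin.castSucc := by
  rw [prevIdx, ← latest_map_castSucc]
  congr 1
  ext m
  induction m using Fin.lastCases <;> simp [Fin.castSucc_lt_last, (Fin.castSucc_lt_last _).ne]

theorem sameIdx_last {τ ℓ : ℕ} (t : Fin (ℓ + 1) → Fin τ) :
    sameIdx t (Fin.last ℓ) =
      (latest (univ.filter fun k : Fin ℓ => t k.castSucc = t (Fin.last ℓ))).map Fin.castSucc := by
  rw [sameIdx, ← latest_map_castSucc]
  congr 1
  ext m
  induction m using Fin.lastCases <;> simp [Fin.castSucc_lt_last, (Fin.castSucc_lt_last _).ne]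

/-! ### Expectations under the law of a Markov kernel -/

section Expectation

variable {τ : ℕ} {K : Option (Response τ) → Option (Response τ) → Fin τ → Response τ → ℝ}

/-- The law of the responses to one more object is that of the earlier responses times the kernel
at the last object. -/
theorem markovLaw_snoc {ℓ : ℕ} (t : Fin (ℓ + 1) → Fin τ) (y : Fin ℓ → Response τ)
    (b : Response τ) :
    markovLaw K t (Fin.snoc (α := fun _ => Response τ) y b) =
      markovLaw K (fun k => t k.castSucc) y *
        K ((latest univ).map y)
          ((latest (univ.filter fun k : Fin ℓ => t k.castSucc = t (Fin.last ℓ))).map y)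
          (t (Fin.last ℓ)) b := by
  have key : (Fin.snoc (α := fun _ => Response τ) y b) ∘ Fin.castSucc = y := by
    funext k; simp
  rw [markovLaw, Fin.prod_univ_castSucc, markovLaw]
  simp only [prevIdx_castSucc, sameIdx_castSucc, prevIdx_last, sameIdx_last, Option.map_map, key,
    Fin.snoc_castSucc, Fin.snoc_last]

theorem sum_fin_succ {ℓ : ℕ} (F : (Fin (ℓ + 1) → Response τ) → ℝ) :
    ∑ y, F y = ∑ y : Fin ℓ → Response τ, ∑ b,
      F (Fin.snoc (α := fun _ => Response τ) y b) := by
  rw [← (Fin.snocEquiv (fun _ : Fin (ℓ + 1) => Response τ)).sum_comp, Fintype.sum_prod_type_right]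
  rfl

theorem sum_markovLaw_succ {ℓ : ℕ} (t : Fin (ℓ + 1) → Fin τ)
    (F : (Fin (ℓ + 1) → Response τ) → ℝ) :
    ∑ y, markovLaw K t y * F y = ∑ y : Fin ℓ → Response τ, markovLaw K (fun k => t k.castSucc) y *
      ∑ b, K ((latest univ).map y)
          ((latest (univ.filter fun k : Fin ℓ => t k.castSucc = t (Fin.last ℓ))).map y)
          (t (Fin.last ℓ)) b * F (Fin.snoc (α := fun _ => Response τ) y b) := by
  rw [sum_fin_succ]
  simp only [markovLaw_snoc, mul_sum, mul_assoc]

theorem sum_markovLaw (hK : ∀ p s t, ∑ b, K p s t b = 1) :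
    ∀ {ℓ : ℕ} (t : Fin ℓ → Fin τ), ∑ y, markovLaw K t y = 1
  | 0, t => by simp [markovLaw]
  | ℓ + 1, t => by
    have h := sum_markovLaw_succ (K := K) t (fun _ => 1)
    simp only [mul_one, hK] at h
    rw [h, sum_markovLaw hK (fun k => t k.castSucc)]

theorem markovLaw_nonneg (hK : ∀ p s t b, 0 ≤ K p s t b) {ℓ : ℕ} (t : Fin ℓ → Fin τ)
    (y : Fin ℓ → Response τ) : 0 ≤ markovLaw K t y :=
  prod_nonneg fun _ _ => hK _ _ _ _

/-- Causality: given the earlier responses, the response to object `i` is drawn from the kernel. -/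
theorem sum_markovLaw_mul (hK : ∀ p s t, ∑ b, K p s t b = 1) :
    ∀ {ℓ : ℕ} (t : Fin ℓ → Fin τ) (i : Fin ℓ) (h : (Fin ℓ → Response τ) → ℝ)
      (_ : ∀ y y' : Fin ℓ → Response τ, (∀ m < i, y m = y' m) → h y = h y') (φ : Response τ → ℝ),
      ∑ y, markovLaw K t y * (h y * φ (y i)) =
        ∑ y, markovLaw K t y *
          (h y * ∑ b, K ((prevIdx i).map y) ((sameIdx t i).map y) (t i) b * φ b)
  | 0, _, i, _, _, _ => i.elim0
  | ℓ + 1, t, i, h, hh, φ => by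
    have key : ∀ (y : Fin ℓ → Response τ) (b : Response τ),
        (Fin.snoc (α := fun _ => Response τ) y b) ∘ Fin.castSucc = y := by
      intro y b; funext k; simp
    rw [sum_markovLaw_succ, sum_markovLaw_succ]
    induction i using Fin.lastCases with
    | last =>
      refine sum_congr rfl fun y _ => ?_
      have hc : ∀ b, h (Fin.snoc (α := fun _ => Response τ) y b) =
          h (Fin.snoc (α := fun _ => Response τ) y none) := fun b => by
        refine hh _ _ fun m hm => ?_
        induction m using Fin.lastCases with
        | last => exact absurd hm (lt_irrefl _)
        | cast m => simp
      simp only [hc _, prevIdx_last, sameIdx_last, Option.map_map, key, Fin.snoc_last]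
      rw [← sum_mul, hK, one_mul]
      simp only [mul_sum]
      exact sum_congr rfl fun b _ => by ring
    | cast i =>
      have hc : ∀ y b, h (Fin.snoc (α := fun _ => Response τ) y b) =
          h (Fin.snoc (α := fun _ => Response τ) y none) := fun y b => by
        refine hh _ _ fun m hm => ?_
        induction m using Fin.lastCases with
        | last => exact absurd hm (Fin.castSucc_lt_last i).not_gt
        | cast m => simp
      simp only [hc _, prevIdx_castSucc, sameIdx_castSucc, Option.map_map, key, Fin.snoc_castSucc,
        ← sum_mul, hK, one_mul]
      refine sum_markovLaw_mul hK (fun k => t k.castSucc) i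
        (fun y => h (Fin.snoc (α := fun _ => Response τ) y none)) (fun y y' hy => ?_) φ
      refine hh _ _ fun m hm => ?_
      induction m using Fin.lastCases with
      | last => exact absurd hm (Fin.castSucc_lt_last i).not_gt
      | cast m => simpa using hy m (by simpa using hm)

end Expectation

/-! ### One-step memory -/

/-- Data for a kernel whose memory reaches back exactly one step within a class: an answer to an
object of class `t` with previous same-class answer `s` has mass `Q t y * (1 + w t y * u t s)`.
The orthogonality relations make `Q t` stationary, and make the square of the transition matrix
the independent coupling. -/
structure StepMemory (τ : ℕ) where
  Q : Fin τ → Response τ → ℝ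
  u : Fin τ → Response τ → ℝ
  w : Fin τ → Response τ → ℝ
  Q_pos : ∀ t y, 0 < Q t y
  sum_Q : ∀ t, ∑ y, Q t y = 1
  sum_Qu : ∀ t, ∑ y, Q t y * u t y = 0
  sum_Qw : ∀ t, ∑ y, Q t y * w t y = 0
  sum_Qwu : ∀ t, ∑ y, Q t y * w t y * u t y = 0
  abs_w_mul_u_le : ∀ t y s, |w t y * u t s| ≤ 1 / 2

namespace StepMemory

variable {τ : ℕ} (σ : StepMemory τ)

/-- The value of `u` at the remembered answer, `0` when there is none. -/
noncomputable def mem (s : Option (Response τ)) (t : Fin τ) : ℝ := s.elim 0 (σ.u t)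

/-- The memory kernel; it ignores the answer to the previous object. -/
noncomputable def kernel (_ s : Option (Response τ)) (t : Fin τ) (y : Response τ) : ℝ :=
  σ.Q t y * (1 + σ.w t y * σ.mem s t)

theorem abs_mul_mem_le (t : Fin τ) (y : Response τ) (s : Option (Response τ)) :
    |σ.w t y * σ.mem s t| ≤ 1 / 2 := by
  cases s with
  | none => simp [mem]
  | some s => exact σ.abs_w_mul_u_le t y s

theorem half_le_kernel (p s : Option (Response τ)) (t : Fin τ) (y : Response τ) :
    σ.Q t y / 2 ≤ σ.kernel p s t y := by
  have h := (abs_le.1 (σ.abs_mul_mem_le t y s)).1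
  unfold kernel
  nlinarith [σ.Q_pos t y]

theorem kernel_nonneg (p s : Option (Response τ)) (t : Fin τ) (y : Response τ) :
    0 ≤ σ.kernel p s t y :=
  (half_pos (σ.Q_pos t y)).le.trans (σ.half_le_kernel p s t y)

theorem sum_kernel_mul (p s : Option (Response τ)) (t : Fin τ) (φ : Response τ → ℝ) :
    ∑ b, σ.kernel p s t b * φ b =
      ∑ b, σ.Q t b * φ b + (∑ b, σ.Q t b * σ.w t b * φ b) * σ.mem s t := by
  rw [sum_mul, ← sum_add_distrib]
  exact sum_congr rfl fun b _ => by unfold kernel; ring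

theorem sum_kernel (p s : Option (Response τ)) (t : Fin τ) : ∑ b, σ.kernel p s t b = 1 := by
  have h := σ.sum_kernel_mul p s t (fun _ => 1)
  simpa [σ.sum_Q, σ.sum_Qw] using h

theorem sum_kernel_mul_u (p s : Option (Response τ)) (t : Fin τ) :
    ∑ b, σ.kernel p s t b * σ.u t b = 0 := by
  rw [sum_kernel_mul, σ.sum_Qu, σ.sum_Qwu, zero_mul, add_zero]

/-- The statistic `u` of the answer to object `k` is uncorrelated with every product of functions
of other answers, as long as no later object of the class of `k` enters the product. Summing out
the last answer turns such a product into a combination of products of the same kind, and at `k`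
itself the orthogonality relations apply. -/
theorem sum_markovLaw_mul_prod_eq_zero :
    ∀ (ℓ : ℕ) (t : Fin ℓ → Fin τ) (k : Fin ℓ) (f : Fin ℓ → Response τ → ℝ)
      (_ : f k = σ.u (t k)) (_ : ∀ m, k < m → t m = t k → f m = fun _ => 1),
      ∑ y, markovLaw σ.kernel t y * ∏ m, f m (y m) = 0 := by
  intro ℓ
  induction ℓ with
  | zero => intro _ k; exact k.elim0
  | succ ℓ ih =>
    intro t k f hk hf
    rw [sum_markovLaw_succ]
    simp only [Fin.prod_univ_castSucc, Fin.snoc_castSucc, Fin.snoc_last]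
    induction k using Fin.lastCases with
    | last =>
      refine sum_eq_zero fun y _ => ?_
      rw [hk]
      simp only [mul_left_comm (σ.kernel _ _ _ _), ← mul_sum, sum_kernel_mul_u,
        mul_zero]
    | cast k =>
      have h0 := ih (fun k => t k.castSucc) k (fun m => f m.castSucc) hk
        (fun m hm => hf m.castSucc (by simpa using hm))
      simp only [mul_left_comm (σ.kernel _ _ _ _), ← mul_sum]
      by_cases hlast : t (Fin.last ℓ) = t k.castSucc
      · rw [hf _ (Fin.castSucc_lt_last k) hlast]
        simpa only [mul_one, sum_kernel] using h0
      simp only [sum_kernel_mul]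
      cases hr : latest (univ.filter fun k : Fin ℓ => t k.castSucc = t (Fin.last ℓ)) with
      | none =>
        simp only [Option.map_none, mem, Option.elim_none, mul_zero, add_zero, ← mul_assoc]
        rw [← sum_mul, h0, zero_mul]
      | some r =>
        have hr' : t r.castSucc = t (Fin.last ℓ) := by
          simpa using (latest_eq_some_iff.1 hr).1
        have hrk : r ≠ k := by rintro rfl; exact hlast hr'.symm
        -- the factor `u` at the remembered object `r` is absorbed into the function at `r`
        have h1 := ih (fun k => t k.castSucc) k
          (Function.update (fun m => f m.castSucc) r
            (fun z => f r.castSucc z * σ.u (t (Fin.last ℓ)) z))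
          (by rw [Function.update_of_ne hrk.symm]; exact hk)
          (fun m hm ht => by
            have hmr : m ≠ r := by rintro rfl; exact hlast (hr'.symm.trans ht)
            rw [Function.update_of_ne hmr]
            exact hf m.castSucc (by simpa using hm) ht)
        have h2 : ∀ y : Fin ℓ → Response τ, (∏ m, Function.update (fun m => f m.castSucc) r
            (fun z => f r.castSucc z * σ.u (t (Fin.last ℓ)) z) m (y m)) =
            (∏ m : Fin ℓ, f m.castSucc (y m)) * σ.u (t (Fin.last ℓ)) (y r) := by
          intro y
          have h3 : ∀ m, Function.update (fun m => f m.castSucc) r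
            (fun z => f r.castSucc z * σ.u (t (Fin.last ℓ)) z) m (y m) =
              f m.castSucc (y m) * (if m = r then σ.u (t (Fin.last ℓ)) (y m) else 1) := by
            intro m
            by_cases hm : m = r
            · subst hm; simp
            · simp [hm]
          simp only [h3, prod_mul_distrib, prod_ite_eq', mem_univ, if_true]
        simp only [h2] at h1
        simp only [Option.map_some, mem, Option.elim_some]
        calc _ = ∑ y, (markovLaw σ.kernel (fun k => t k.castSucc) y *
                  ∏ m : Fin ℓ, f m.castSucc (y m)) *
                    (∑ b, σ.Q (t (Fin.last ℓ)) b * f (Fin.last ℓ) b) +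
              ∑ y, (markovLaw σ.kernel (fun k => t k.castSucc) y *
                  ((∏ m : Fin ℓ, f m.castSucc (y m)) * σ.u (t (Fin.last ℓ)) (y r))) *
                    (∑ b, σ.Q (t (Fin.last ℓ)) b * σ.w (t (Fin.last ℓ)) b * f (Fin.last ℓ) b) := by
              rw [← sum_add_distrib]
              exact sum_congr rfl fun y _ => by ring
          _ = 0 := by rw [← sum_mul, ← sum_mul, h0, h1, zero_mul, zero_mul, add_zero]

theorem sum_markovLaw_mul_u {ℓ : ℕ} (t : Fin ℓ → Fin τ) (k : Fin ℓ) :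
    ∑ y, markovLaw σ.kernel t y * σ.u (t k) (y k) = 0 := by
  have h := σ.sum_markovLaw_mul_prod_eq_zero ℓ t k
    (fun m z => if m = k then σ.u (t k) z else 1) (by simp)
    (fun m hm _ => by simp [hm.ne'])
  simpa [prod_ite_eq'] using h

/-- The response at `i` given a function `h` of earlier responses. -/
theorem sum_markovLaw_mul_apply {ℓ : ℕ} (t : Fin ℓ → Fin τ) (i : Fin ℓ)
    (h : (Fin ℓ → Response τ) → ℝ)
    (hh : ∀ y y' : Fin ℓ → Response τ, (∀ m < i, y m = y' m) → h y = h y') (a : Response τ) :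
    ∑ y, markovLaw σ.kernel t y * (h y * if y i = a then 1 else 0) =
      σ.Q (t i) a * ∑ y, markovLaw σ.kernel t y * h y +
        σ.Q (t i) a * σ.w (t i) a *
          ∑ y, markovLaw σ.kernel t y * (h y * σ.mem ((sameIdx t i).map y) (t i)) := by
  rw [sum_markovLaw_mul σ.sum_kernel t i h hh (fun b => if b = a then 1 else 0), mul_sum, mul_sum,
    ← sum_add_distrib]
  refine sum_congr rfl fun y _ => ?_
  rw [sum_kernel_mul]
  simp only [mul_ite, mul_one, mul_zero, sum_ite_eq', mem_univ, if_true]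
  ring

theorem sum_filter_markovLaw {ℓ : ℕ} (t : Fin ℓ → Fin τ) (i : Fin ℓ) (a : Response τ) :
    ∑ y ∈ univ.filter (fun y : Fin ℓ → Response τ => y i = a), markovLaw σ.kernel t y
      = σ.Q (t i) a := by
  have h := σ.sum_markovLaw_mul_apply t i (fun _ => 1) (fun _ _ _ => rfl) a
  simp only [mul_one, one_mul, sum_markovLaw σ.sum_kernel] at h
  rw [sum_filter]
  simp only [mul_ite, mul_one, mul_zero] at h
  rw [h]
  cases hk : sameIdx t i with
  | none => simp [mem]
  | some k =>
    have := (sameIdx_eq_some_iff.1 hk).1.2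
    simp only [Option.map_some, mem, Option.elim_some, ← this, sum_markovLaw_mul_u]
    ring

/-- The worker with one-step memory. -/
noncomputable def toWorker (ℓ : ℕ) : Worker τ ℓ where
  kernel := σ.kernel
  kernel_mem p s t := ⟨fun y => σ.kernel_nonneg p s t y, σ.sum_kernel p s t⟩
  marg := σ.Q
  marg_mem t := ⟨fun y => (σ.Q_pos t y).le, σ.sum_Q t⟩
  marginal t i a := σ.sum_filter_markovLaw t i a

/-- The pool that consists of one worker with one-step memory. -/
noncomputable def toPool (ℓ : ℕ) : WorkerPool τ ℓ where
  size := 1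
  worker _ := σ.toWorker ℓ
  weight _ := 1
  weight_mem := ⟨fun _ => zero_le_one, by simp⟩

theorem law_toPool {ℓ : ℕ} (t : Fin ℓ → Fin τ) :
    (σ.toPool ℓ).law t = markovLaw σ.kernel t := by
  funext y
  exact (Fin.sum_univ_one _).trans (one_mul _)

theorem resp_toPool (ℓ : ℕ) (t : Fin τ) : (σ.toPool ℓ).resp t = σ.Q t := by
  funext y
  exact (Fin.sum_univ_one _).trans (one_mul _)

/-! ### Mutual information of one-step memory -/

theorem sum_massOf_mul {Ω α : Type} [Fintype Ω] [Fintype α] (p : Ω → ℝ) (X : Ω → α)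
    (G : α → ℝ) : ∑ a, massOf p X a * G a = ∑ ω, p ω * G (X ω) := by
  classical
  rw [← sum_fiberwise univ X]
  refine sum_congr rfl fun a _ => ?_
  unfold massOf
  rw [sum_mul]
  refine sum_congr (by ext; simp) fun ω hω => ?_
  rw [(mem_filter.1 hω).2]

theorem massOf_apply {ℓ : ℕ} (t : Fin ℓ → Fin τ) (i : Fin ℓ) (a : Response τ) :
    massOf (markovLaw σ.kernel t) (fun y => y i) a = σ.Q (t i) a := by
  rw [← σ.sum_filter_markovLaw t i a]
  unfold massOf
  exact sum_congr (by ext; simp) fun _ _ => rfl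

/-- The mutual information of two consecutive answers to objects of class `t`. -/
noncomputable def stepInfo (t : Fin τ) : ℝ :=
  ∑ a, ∑ c, σ.Q t c * (σ.Q t a * ((1 + σ.w t a * σ.u t c) *
    Real.logb 2 (1 + σ.w t a * σ.u t c)))

theorem massOf_eq_sum {Ω α : Type} [Fintype Ω] [DecidableEq α] (p : Ω → ℝ) (X : Ω → α) (a : α) :
    massOf p X a = ∑ ω, p ω * if X ω = a then 1 else 0 := by
  unfold massOf
  rw [sum_filter]
  exact sum_congr rfl fun ω _ => by split_ifs <;> simp

theorem massOf_pair {ℓ : ℕ} (t : Fin ℓ → Fin τ) (i : Fin ℓ) (S : Finset (Fin ℓ))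
    (hS : ∀ j ∈ S, j < i) (a : Response τ) (z : S → Response τ) :
    massOf (markovLaw σ.kernel t) (fun y => (y i, fun j : S => y j)) (a, z) =
      σ.Q (t i) a * massOf (markovLaw σ.kernel t) (fun y (j : S) => y j) z +
        σ.Q (t i) a * σ.w (t i) a * ∑ y, markovLaw σ.kernel t y *
          ((if (fun j : S => y j) = z then 1 else 0) *
            σ.mem ((sameIdx t i).map y) (t i)) := by
  rw [massOf_eq_sum, massOf_eq_sum, ← σ.sum_markovLaw_mul_apply]
  · refine sum_congr rfl fun y _ => ?_
    congr 1
    by_cases h1 : y i = a <;> by_cases h2 : (fun j : S => y j) = z <;> simp [h1, h2]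
  · intro y y' h
    have : (fun j : S => y j) = fun j : S => y' j := funext fun j => h j (hS j j.2)
    rw [this]

/-- If the most recent object of the same class is not observed, the answer is independent of the
observed answers. -/
theorem info_eq_zero {ℓ : ℕ} (t : Fin ℓ → Fin τ) (i k : Fin ℓ) (S : Finset (Fin ℓ))
    (hS : ∀ j ∈ S, j < i) (hk : sameIdx t i = some k) (hkS : k ∉ S) :
    (σ.toPool ℓ).info t i S = 0 := by
  obtain ⟨⟨hki, hkt⟩, hmax⟩ := sameIdx_eq_some_iff.1 hk
  unfold WorkerPool.info mutualInfo
  rw [law_toPool]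
  refine sum_eq_zero fun a _ => sum_eq_zero fun z _ => ?_
  have h0 : ∑ y, markovLaw σ.kernel t y * ((if (fun j : S => y j) = z then 1 else 0) *
      σ.mem ((sameIdx t i).map y) (t i)) = 0 := by
    refine Eq.trans ?_ (σ.sum_markovLaw_mul_prod_eq_zero ℓ t k
      (fun m b => if m = k then σ.u (t k) b else
        if h : m ∈ S then (if b = z ⟨m, h⟩ then 1 else 0) else 1) (by simp)
      (fun m hm ht => by
        have : m ∉ S := fun h => (hmax m (hS m h) (ht.trans hkt)).not_gt hm
        simp [this, hm.ne']))
    refine sum_congr rfl fun y _ => ?_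
    congr 1
    rw [hk, ← hkt, ← prod_erase_mul _ _ (mem_univ k)]
    simp only [if_true]
    congr 1
    by_cases hz : (fun j : S => y j) = z
    · rw [if_pos hz]
      refine (prod_eq_one fun m hm => ?_).symm
      rw [if_neg (ne_of_mem_erase hm)]
      split_ifs with h1 h2
      · rfl
      · exact absurd (congrFun hz ⟨m, h1⟩) h2
      · rfl
    · rw [if_neg hz]
      obtain ⟨⟨m, hm⟩, hne⟩ := Function.ne_iff.1 hz
      refine (prod_eq_zero (i := m) ?_ ?_).symm
      · exact mem_erase.2 ⟨fun h => hkS (h ▸ hm), mem_univ _⟩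
      · have : m ≠ k := fun h => hkS (h ▸ hm)
        simp only [if_neg this, dif_pos hm]
        exact if_neg hne
  rw [σ.massOf_pair t i S hS, h0, mul_zero, add_zero, massOf_apply]
  by_cases h : σ.Q (t i) a * massOf (markovLaw σ.kernel t) (fun y (j : S) => y j) z = 0
  · rw [h, zero_mul]
  · rw [div_self h, Real.logb_one, mul_zero]

/-- If the most recent object of the same class is observed, the other observations do not
contribute to the information. -/
theorem info_eq_stepInfo {ℓ : ℕ} (t : Fin ℓ → Fin τ) (i k : Fin ℓ) (S : Finset (Fin ℓ))
    (hS : ∀ j ∈ S, j < i) (hk : sameIdx t i = some k) (hkS : k ∈ S) :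
    (σ.toPool ℓ).info t i S = σ.stepInfo (t i) := by
  obtain ⟨⟨hki, hkt⟩, hmax⟩ := sameIdx_eq_some_iff.1 hk
  unfold WorkerPool.info mutualInfo stepInfo
  rw [law_toPool]
  refine sum_congr rfl fun a _ => ?_
  have hpair : ∀ z : S → Response τ,
      massOf (markovLaw σ.kernel t) (fun y => (y i, fun j : S => y j)) (a, z) =
      (σ.Q (t i) a * massOf (markovLaw σ.kernel t) (fun y (j : S) => y j) z) *
        (1 + σ.w (t i) a * σ.u (t i) (z ⟨k, hkS⟩)) := by
    intro z
    have h0 : ∑ y, markovLaw σ.kernel t y * ((if (fun j : S => y j) = z then 1 else 0) *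
        σ.mem ((sameIdx t i).map y) (t i)) =
        massOf (markovLaw σ.kernel t) (fun y (j : S) => y j) z * σ.u (t i) (z ⟨k, hkS⟩) := by
      rw [massOf_eq_sum, sum_mul]
      refine sum_congr rfl fun y _ => ?_
      by_cases hz : (fun j : S => y j) = z
      · rw [if_pos hz, hk, ← hz]
        simp [mem]
      · simp [hz]
    rw [σ.massOf_pair t i S hS, h0]
    ring
  calc _ = ∑ z : S → Response τ, massOf (markovLaw σ.kernel t) (fun y (j : S) => y j) z *
        (σ.Q (t i) a * ((1 + σ.w (t i) a * σ.u (t i) (z ⟨k, hkS⟩)) *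
          Real.logb 2 (1 + σ.w (t i) a * σ.u (t i) (z ⟨k, hkS⟩)))) := by
        refine sum_congr rfl fun z _ => ?_
        rw [hpair, massOf_apply]
        by_cases h : massOf (markovLaw σ.kernel t) (fun y (j : S) => y j) z = 0
        · simp [h]
        · rw [mul_div_cancel_left₀ _ (mul_ne_zero (σ.Q_pos (t i) a).ne' h)]
          ring
    _ = ∑ c, massOf (markovLaw σ.kernel t) (fun y => y k) c *
        (σ.Q (t i) a * ((1 + σ.w (t i) a * σ.u (t i) c) *
          Real.logb 2 (1 + σ.w (t i) a * σ.u (t i) c))) := by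
        rw [sum_massOf_mul _ _ (fun c => σ.Q (t i) a * ((1 + σ.w (t i) a * σ.u (t i) c) *
          Real.logb 2 (1 + σ.w (t i) a * σ.u (t i) c))),
          sum_massOf_mul _ _ (fun z : S → Response τ =>
            σ.Q (t i) a * ((1 + σ.w (t i) a * σ.u (t i) (z ⟨k, hkS⟩)) *
          Real.logb 2 (1 + σ.w (t i) a * σ.u (t i) (z ⟨k, hkS⟩))))]
    _ = _ := by simp only [massOf_apply, hkt]

theorem lt_of_mem_prevIdx {ℓ : ℕ} {i j : Fin ℓ} (h : j ∈ (prevIdx i).toFinset) : j < i := by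
  rw [Option.mem_toFinset, Option.mem_def, prevIdx_eq_some_iff] at h
  exact h.1

/-- If consecutive answers carry the same information `v` in all classes, then the memory quality
is `v / 2`: non-neighbours carry no information. -/
theorem memQuality_toPool {ℓ : ℕ} (hτ : 0 < τ) (hℓ : 2 ≤ ℓ) {v : ℝ}
    (hv : ∀ t, σ.stepInfo t = v) : (σ.toPool ℓ).memQuality = v / 2 := by
  have h1 : {x | ∃ (t : Fin ℓ → Fin τ) (i : Fin ℓ), sameIdx t i ≠ none ∧
      x = (σ.toPool ℓ).info t i (nbr t i)} = {v} := by
    have hval : ∀ (t : Fin ℓ → Fin τ) (i : Fin ℓ), sameIdx t i ≠ none →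
        (σ.toPool ℓ).info t i (nbr t i) = v := by
      intro t i h
      obtain ⟨k, hk⟩ := Option.ne_none_iff_exists'.1 h
      rw [σ.info_eq_stepInfo t i k, hv]
      · intro j hj
        rcases mem_union.1 hj with hj | hj
        · exact lt_of_mem_prevIdx hj
        · rw [Option.mem_toFinset, Option.mem_def, sameIdx_eq_some_iff] at hj
          exact hj.1.1
      · exact hk
      · exact mem_union_right _ (by simp [hk])
    ext x
    constructor
    · rintro ⟨t, i, h, rfl⟩
      exact hval t i h
    · rintro rfl
      have hne : sameIdx (fun _ : Fin ℓ => (⟨0, hτ⟩ : Fin τ)) ⟨1, hℓ⟩ ≠ none := by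
        rw [sameIdx, Ne, latest_eq_none_iff, ← Ne, ← nonempty_iff_ne_empty]
        exact ⟨⟨0, by omega⟩, by simp [Fin.lt_def]⟩
      exact ⟨_, _, hne, (hval _ _ hne).symm⟩
  have h2 : ∀ x ∈ {x | ∃ (t : Fin ℓ → Fin τ) (i j : Fin ℓ), sameIdx t i ≠ none ∧
        sameIdx t i ≠ prevIdx i ∧ j < i ∧ j ∉ nbr t i ∧
        x = (σ.toPool ℓ).info t i ((prevIdx i).toFinset ∪ {j})}, x = 0 := by
    rintro x ⟨t, i, j, h, hp, hji, hj, rfl⟩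
    obtain ⟨k, hk⟩ := Option.ne_none_iff_exists'.1 h
    refine σ.info_eq_zero t i k _ (fun m hm => ?_) hk fun hm => ?_
    · rcases mem_union.1 hm with hm | hm
      · exact lt_of_mem_prevIdx hm
      · rw [mem_singleton.1 hm]; exact hji
    · rcases mem_union.1 hm with hm | hm
      · rw [Option.mem_toFinset, Option.mem_def] at hm
        exact hp (hk.trans hm.symm)
      · rw [mem_singleton] at hm
        exact hj (mem_union_right _ (by simp [hk, hm]))
  have h3 : sSup {x | ∃ (t : Fin ℓ → Fin τ) (i j : Fin ℓ), sameIdx t i ≠ none ∧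
        sameIdx t i ≠ prevIdx i ∧ j < i ∧ j ∉ nbr t i ∧
        x = (σ.toPool ℓ).info t i ((prevIdx i).toFinset ∪ {j})} = 0 :=
    le_antisymm (Real.sSup_nonpos fun x hx => (h2 x hx).le)
      (Real.sSup_nonneg fun x hx => (h2 x hx).ge)
  rw [WorkerPool.memQuality, h1, h3, csInf_singleton, sub_zero]

end StepMemory

/-! ### Pools with prescribed qualities -/

theorem self_le_mul_log_one_add {z : ℝ} (hz : -1 < z) : z ≤ (1 + z) * Real.log (1 + z) := by
  have h1 : 0 < 1 + z := by linarith
  have h := Real.one_sub_inv_le_log_of_pos h1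
  calc z = (1 + z) * (1 - (1 + z)⁻¹) := by field_simp; ring
    _ ≤ _ := mul_le_mul_of_nonneg_left h h1.le

theorem add_sq_le_mul_log_one_add {z : ℝ} (hz : 0 ≤ z) (hz1 : z ≤ 1) :
    z + z ^ 2 / 3 ≤ (1 + z) * Real.log (1 + z) := by
  have h := Real.le_log_one_add_of_nonneg hz
  refine le_trans ?_ (mul_le_mul_of_nonneg_left h (by linarith))
  rw [mul_div_assoc', le_div_iff₀ (by linarith)]
  nlinarith [mul_nonneg (sq_nonneg z) (sub_nonneg.2 hz1)]

section TwoSymbol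

variable {τ : ℕ}

/-- The uniform distribution on the responses, shifted towards the correct class by mass `r`. -/
noncomputable def tiltedMarg (τ : ℕ) (r : ℝ) (t : Fin τ) (y : Response τ) : ℝ :=
  (1 - r) / (τ + 1) + if y = some t then r else 0

/-- The remembered statistic: it compares the null response with one wrong class `o t`. -/
noncomputable def memStat (o : Fin τ → Fin τ) (t : Fin τ) (y : Response τ) : ℝ :=
  (if y = none then 1 else 0) - if y = some (o t) then 1 else 0

/-- The direction in which memory shifts an answer: towards the null response and the wrong class
`o t` alike, away from the correct class. -/
noncomputable def memShift (r : ℝ) (o : Fin τ → Fin τ) (t : Fin τ) (y : Response τ) : ℝ :=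
  (if y = none then 1 else 0) + (if y = some (o t) then 1 else 0) -
    if y = some t then 2 * ((1 - r) / (τ + 1)) / ((1 - r) / (τ + 1) + r) else 0

theorem level_pos {r : ℝ} (hr1 : r < 1) : 0 < (1 - r) / ((τ : ℝ) + 1) :=
  div_pos (sub_pos.2 hr1) (by positivity)

theorem tiltedMarg_pos {r : ℝ} (hr : 0 ≤ r) (hr1 : r < 1) (t : Fin τ) (y : Response τ) :
    0 < tiltedMarg τ r t y := by
  have := level_pos (τ := τ) hr1
  unfold tiltedMarg
  split_ifs <;> linarith

theorem level_le_tiltedMarg {r : ℝ} (hr : 0 ≤ r) (t : Fin τ) (y : Response τ) :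
    (1 - r) / (τ + 1) ≤ tiltedMarg τ r t y := by
  unfold tiltedMarg
  split_ifs <;> linarith

theorem sum_tiltedMarg (r : ℝ) (t : Fin τ) : ∑ y, tiltedMarg τ r t y = 1 := by
  unfold tiltedMarg
  rw [sum_add_distrib, sum_const, sum_ite_eq' univ (some t) fun _ => r, if_pos (mem_univ _),
    card_univ, Fintype.card_option, Fintype.card_fin, nsmul_eq_mul]
  push_cast
  field_simp
  ring

theorem sum_mul_memStat (o : Fin τ → Fin τ) (t : Fin τ) (F : Response τ → ℝ) :
    ∑ y, F y * memStat o t y = F none - F (some (o t)) := by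
  unfold memStat
  simp only [mul_sub, sum_sub_distrib, mul_ite, mul_one, mul_zero]
  rw [sum_ite_eq' univ none F, sum_ite_eq' univ (some (o t)) F]
  simp

theorem sum_tiltedMarg_mul_memShift {r : ℝ} (hr : 0 ≤ r) (hr1 : r < 1) {o : Fin τ → Fin τ}
    (ho : ∀ t, o t ≠ t) (t : Fin τ) : ∑ y, tiltedMarg τ r t y * memShift r o t y = 0 := by
  have hq := level_pos (τ := τ) hr1
  unfold memShift
  simp only [mul_sub, mul_add, sum_sub_distrib, sum_add_distrib, mul_ite, mul_one, mul_zero]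
  rw [sum_ite_eq' univ none (tiltedMarg τ r t), sum_ite_eq' univ (some (o t)) (tiltedMarg τ r t),
    sum_ite_eq' univ (some t) fun y => tiltedMarg τ r t y *
      (2 * ((1 - r) / (τ + 1)) / ((1 - r) / (τ + 1) + r))]
  simp only [mem_univ, if_true, tiltedMarg, reduceCtorEq, if_false, Option.some_inj, ho t]
  rw [mul_div_cancel₀ _ (by linarith : 0 < (1 - r) / ((τ : ℝ) + 1) + r).ne']
  ring

theorem abs_memStat_le (o : Fin τ → Fin τ) (t : Fin τ) (y : Response τ) :
    |memStat o t y| ≤ 1 := by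
  unfold memStat
  split_ifs <;> simp_all

theorem abs_memShift_le {r : ℝ} (hr : 0 ≤ r) (hr1 : r < 1) {o : Fin τ → Fin τ}
    (ho : ∀ t, o t ≠ t) (t : Fin τ) (y : Response τ) : |memShift r o t y| ≤ 2 := by
  have hq := level_pos (τ := τ) hr1
  have h1 : 2 * ((1 - r) / ((τ : ℝ) + 1)) / ((1 - r) / (τ + 1) + r) ≤ 2 := by
    rw [div_le_iff₀ (by linarith)]; linarith
  have h0 : 0 ≤ 2 * ((1 - r) / ((τ : ℝ) + 1)) / ((1 - r) / (τ + 1) + r) := by positivity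
  have ho' := ho t
  unfold memShift
  rw [abs_le]
  rcases y with _ | y
  · simp only [if_true, reduceCtorEq, if_false]
    norm_num
  · by_cases h2 : y = o t
    · subst h2
      simp only [reduceCtorEq, if_false, Option.some_inj, ho', if_true]
      norm_num
    · by_cases h3 : y = t
      · subst h3
        simp only [reduceCtorEq, if_false, Option.some_inj, h2, if_true]
        constructor <;> linarith
      · simp [h2, h3]

/-- One-step memory of strength `e t` in class `t`. -/
noncomputable def tiltedMemory {r : ℝ} (hr : 0 ≤ r) (hr1 : r < 1) {o : Fin τ → Fin τ} (ho : ∀ t, o t ≠ t)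
    {e : Fin τ → ℝ} (he : ∀ t, 0 ≤ e t ∧ e t ≤ 1 / 4) : StepMemory τ where
  Q := tiltedMarg τ r
  u := memStat o
  w t y := e t * memShift r o t y
  Q_pos := tiltedMarg_pos hr hr1
  sum_Q := sum_tiltedMarg r
  sum_Qu t := by
    rw [sum_mul_memStat]
    simp [tiltedMarg, ho t]
  sum_Qw t := by
    simp only [mul_left_comm _ (e t), ← mul_sum, sum_tiltedMarg_mul_memShift hr hr1 ho, mul_zero]
  sum_Qwu t := by
    rw [sum_mul_memStat o t fun y => tiltedMarg τ r t y * (e t * memShift r o t y)]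
    simp [tiltedMarg, memShift, ho t]
  abs_w_mul_u_le t y s := by
    rw [abs_mul, abs_mul, abs_of_nonneg (he t).1]
    have h1 := abs_memShift_le hr hr1 ho t y
    have h2 := abs_memStat_le o t s
    calc e t * |memShift r o t y| * |memStat o t s| ≤ (1 / 4 * 2) * 1 := by
          gcongr
          exact (he t).2
      _ = 1 / 2 := by norm_num

/-- The step information as a function of the strength `x` of the memory. -/
noncomputable def tiltedInfo (r : ℝ) (o : Fin τ → Fin τ) (t : Fin τ) (x : ℝ) : ℝ :=
  ∑ a, ∑ c, tiltedMarg τ r t c * (tiltedMarg τ r t a *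
    ((1 + x * memShift r o t a * memStat o t c) *
      Real.logb 2 (1 + x * memShift r o t a * memStat o t c)))

theorem continuous_tiltedInfo (r : ℝ) (o : Fin τ → Fin τ) (t : Fin τ) :
    Continuous (tiltedInfo r o t) := by
  have h : Continuous fun z : ℝ => z * Real.logb 2 z := by
    simp only [Real.logb, ← mul_div_assoc]
    exact Real.continuous_mul_log.div_const _
  refine continuous_finsetSum _ fun a _ => continuous_finsetSum _ fun c _ =>
    continuous_const.mul (continuous_const.mul ?_)
  exact h.comp (by fun_prop)

/-- The information is at least quadratic in the strength of the memory: the linear terms cancel,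
and the pair of two null responses contributes a quadratic one. -/
theorem le_tiltedInfo {r : ℝ} (hr : 0 ≤ r) (hr1 : r < 1) {o : Fin τ → Fin τ}
    (ho : ∀ t, o t ≠ t) (t : Fin τ) {x : ℝ} (hx : 0 ≤ x) (hx1 : x ≤ 1 / 4) :
    ((1 - r) / (τ + 1)) ^ 2 * x ^ 2 / 3 ≤ tiltedInfo r o t x := by
  set q : ℝ := (1 - r) / (τ + 1) with hq
  have hlog : 0 < Real.log 2 := Real.log_pos (by norm_num)
  have hlog1 : Real.log 2 ≤ 1 := by linarith [Real.log_two_lt_d9]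
  have hpt : ∀ a c, tiltedMarg τ r t c * (tiltedMarg τ r t a *
      (x * memShift r o t a * memStat o t c)) +
        (if a = none then if c = none then q ^ 2 * x ^ 2 / 3 else 0 else 0) ≤
      tiltedMarg τ r t c * (tiltedMarg τ r t a *
        ((1 + x * memShift r o t a * memStat o t c) *
          Real.log (1 + x * memShift r o t a * memStat o t c))) := by
    intro a c
    have hc := tiltedMarg_pos hr hr1 t c
    have ha := tiltedMarg_pos hr hr1 t a
    have hz : |x * memShift r o t a * memStat o t c| ≤ 1 / 2 := by
      rw [abs_mul, abs_mul, abs_of_nonneg hx]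
      calc x * |memShift r o t a| * |memStat o t c| ≤ (1 / 4 * 2) * 1 := by
            gcongr
            · exact abs_memShift_le hr hr1 ho t a
            · exact abs_memStat_le o t c
        _ = 1 / 2 := by norm_num
    have hz' := (abs_le.1 hz).1
    have hgen := self_le_mul_log_one_add (z := x * memShift r o t a * memStat o t c) (by linarith)
    by_cases h : a = none ∧ c = none
    · obtain ⟨rfl, rfl⟩ := h
      have hQ : tiltedMarg τ r t none = q := by simp [tiltedMarg, hq]
      have hs : memShift r o t none = 1 := by simp [memShift]
      have hm : memStat o t none = 1 := by simp [memStat]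
      simp only [if_true, hQ, hs, hm, mul_one]
      have := add_sq_le_mul_log_one_add hx (by linarith)
      calc _ = q * (q * (x + x ^ 2 / 3)) := by ring
        _ ≤ _ := by rw [hQ] at hc; gcongr
    · have : (if a = none then if c = none then q ^ 2 * x ^ 2 / 3 else 0 else 0) = 0 := by
        split_ifs <;> simp_all
      rw [this, add_zero]
      gcongr
  have hsum := sum_le_sum fun a (_ : a ∈ univ) => sum_le_sum fun c (_ : c ∈ univ) => hpt a c
  have hlin : ∑ a, ∑ c, tiltedMarg τ r t c * (tiltedMarg τ r t a *
      (x * memShift r o t a * memStat o t c)) = 0 := by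
    refine sum_eq_zero fun a _ => ?_
    have : ∀ c, tiltedMarg τ r t c * (tiltedMarg τ r t a *
      (x * memShift r o t a * memStat o t c)) =
        tiltedMarg τ r t a * (x * memShift r o t a) * (tiltedMarg τ r t c * memStat o t c) :=
      fun c => by ring
    simp only [this, ← mul_sum]
    rw [sum_mul_memStat]
    simp [tiltedMarg, ho t]
  simp only [sum_add_distrib] at hsum
  rw [hlin, zero_add] at hsum
  have hdelta : ∑ a : Response τ, ∑ c : Response τ,
      (if a = none then if c = none then q ^ 2 * x ^ 2 / 3 else 0 else 0) =
        q ^ 2 * x ^ 2 / 3 := by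
    rw [sum_eq_single none (by intro b _ hb; simp [hb]) (by simp)]
    simp only [if_true]
    rw [sum_eq_single none (by intro b _ hb; simp [hb]) (by simp), if_pos rfl]
  rw [hdelta] at hsum
  have hG : tiltedInfo r o t x = (∑ a, ∑ c, tiltedMarg τ r t c * (tiltedMarg τ r t a *
        ((1 + x * memShift r o t a * memStat o t c) *
          Real.log (1 + x * memShift r o t a * memStat o t c)))) / Real.log 2 := by
    simp only [tiltedInfo, Real.logb, ← mul_div_assoc, ← sum_div]
  rw [hG, le_div_iff₀ hlog]
  exact le_trans (mul_le_of_le_one_right (by positivity) hlog1) hsum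

theorem tiltedInfo_zero (r : ℝ) (o : Fin τ → Fin τ) (t : Fin τ) : tiltedInfo r o t 0 = 0 := by
  simp [tiltedInfo]

/-- Strengths of memory that produce a prescribed step information exist, by continuity; they are
at most of the order of the square root of the information. -/
theorem exists_stepMemory (hτ : 2 ≤ τ) {r θ : ℝ} (hr : 0 ≤ r) (hr1 : r < 1) (hθ : 0 ≤ θ)
    (hθ1 : θ ≤ ((1 - r) / (τ + 1)) ^ 2 / 96) :
    ∃ (σ : StepMemory τ) (e : Fin τ → ℝ), σ.Q = tiltedMarg τ r ∧ (∀ t, σ.stepInfo t = 2 * θ) ∧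
      ∀ t, 0 ≤ e t ∧ e t ≤ 1 / 4 ∧ ((1 - r) / (τ + 1)) ^ 2 * e t ^ 2 ≤ 6 * θ ∧
        ∀ y s, |σ.w t y * σ.u t s| ≤ 2 * e t := by
  have : Nontrivial (Fin τ) := Fin.nontrivial_iff_two_le.2 hτ
  choose o ho using fun t : Fin τ => exists_ne t
  have hex : ∀ t, ∃ x ∈ Set.Icc (0 : ℝ) (1 / 4), tiltedInfo r o t x = 2 * θ := by
    intro t
    have h := intermediate_value_Icc (by norm_num : (0 : ℝ) ≤ 1 / 4)
      (continuous_tiltedInfo r o t).continuousOn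
    refine h ⟨by rw [tiltedInfo_zero]; linarith, ?_⟩
    have h2 := le_tiltedInfo hr hr1 ho t (x := 1 / 4) (by norm_num) le_rfl
    refine le_trans ?_ h2
    linarith
  choose e he hinfo using hex
  refine ⟨tiltedMemory hr hr1 ho he, e, rfl, hinfo, fun t => ⟨(he t).1, (he t).2, ?_, ?_⟩⟩
  · have h := le_tiltedInfo hr hr1 ho t (he t).1 (he t).2
    rw [hinfo] at h
    linarith
  · intro y s
    change |e t * memShift r o t y * memStat o t s| ≤ _
    rw [abs_mul, abs_mul, abs_of_nonneg (he t).1]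
    have h1 := abs_memShift_le hr hr1 ho t y
    have h2 := abs_memStat_le o t s
    calc e t * |memShift r o t y| * |memStat o t s| ≤ (e t * 2) * 1 := by
          have := (he t).1
          gcongr
      _ = 2 * e t := by ring

theorem tvDist_tiltedMarg {r : ℝ} (hr : 0 ≤ r) {s t : Fin τ} (hst : s ≠ t) :
    tvDist (tiltedMarg τ r s) (tiltedMarg τ r t) = 2 * r := by
  have h : ∀ y, |tiltedMarg τ r s y - tiltedMarg τ r t y| =
      (if y = some s then r else 0) + if y = some t then r else 0 := by
    intro y
    unfold tiltedMarg
    rw [add_sub_add_left_eq_sub]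
    by_cases h1 : y = some s
    · have h2 : y ≠ some t := by rw [h1]; simpa using hst
      simp [h1, hst, abs_of_nonneg hr]
    · by_cases h2 : y = some t
      · simp [h2, hst.symm, abs_of_nonneg hr]
      · simp [h1, h2]
  unfold tvDist
  simp only [h]
  rw [sum_add_distrib, sum_ite_eq' univ (some s) fun _ => r, sum_ite_eq' univ (some t) fun _ => r]
  simp only [mem_univ, if_true]
  ring

theorem StepMemory.hasQuality (hτ : 2 ≤ τ) (σ : StepMemory τ) {ℓ : ℕ} (hℓ : 2 ≤ ℓ) {r θ : ℝ}
    (hr : 0 ≤ r) (hQ : σ.Q = tiltedMarg τ r) (hinfo : ∀ t, σ.stepInfo t = 2 * θ) :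
    (σ.toPool ℓ).HasQuality θ (2 * r) := by
  refine ⟨by rw [σ.memQuality_toPool (by omega) hℓ hinfo]; ring, ?_⟩
  have : {d | ∃ s t : Fin τ, s ≠ t ∧
      d = tvDist ((σ.toPool ℓ).resp s) ((σ.toPool ℓ).resp t)} = {2 * r} := by
    ext d
    simp only [σ.resp_toPool, hQ, Set.mem_ofPred_eq, Set.mem_singleton_iff]
    constructor
    · rintro ⟨s, t, hst, rfl⟩
      exact tvDist_tiltedMarg hr hst
    · rintro rfl
      exact ⟨⟨0, by omega⟩, ⟨1, hτ⟩, by simp, (tvDist_tiltedMarg hr (by simp)).symm⟩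
  rw [WorkerPool.distQuality, this, csInf_singleton]

theorem StepMemory.isNoisy (hτ : 2 ≤ τ) (σ : StepMemory τ) (ℓ : ℕ) {κ : ℝ}
    (hκ : ∀ t y, 2 * κ ≤ σ.Q t y) : (σ.toPool ℓ).IsNoisy κ := by
  refine ⟨⟨0, by omega⟩, ⟨1, hτ⟩, by simp, fun _ => ⟨univ, fun p s _ _ t _ y =>
    ⟨fun _ => ?_, fun h => absurd (mem_univ y) h⟩⟩⟩
  have h := σ.half_le_kernel p s t y
  have h2 := hκ t y
  change κ ≤ σ.kernel p s t y
  linarith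

/-- All small memory qualities, combined with all distance qualities bounded away from `2`, are
attained by noisy pools. -/
theorem exists_noisy_pool (hτ : 2 ≤ τ) (d : ℝ) (hd : d < 2) :
    ∃ m κ : ℝ, 0 < m ∧ 0 < κ ∧ ∀ θm θd : ℝ, 0 ≤ θm → θm ≤ m →
      0 ≤ θd → θd ≤ d → ∀ ℓ : ℕ, 2 ≤ ℓ →
        ∃ R : WorkerPool τ ℓ, R.HasQuality θm θd ∧ R.IsNoisy κ := by
  have hq0 := level_pos (τ := τ) (r := d / 2) (by linarith)
  refine ⟨((1 - d / 2) / (τ + 1)) ^ 2 / 96, (1 - d / 2) / (τ + 1) / 2, by positivity,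
    by positivity, fun θm θd hm hm1 hθd hθd1 ℓ hℓ => ?_⟩
  have hq : (1 - d / 2) / ((τ : ℝ) + 1) ≤ (1 - θd / 2) / (τ + 1) := by gcongr
  obtain ⟨σ, e, hQ, hinfo, -⟩ := exists_stepMemory hτ (r := θd / 2) (θ := θm) (by linarith)
    (by linarith) hm (hm1.trans (by gcongr))
  refine ⟨σ.toPool ℓ, ?_, σ.isNoisy hτ ℓ fun t y => ?_⟩
  · have h := σ.hasQuality hτ hℓ (by linarith) hQ hinfo
    rwa [mul_div_cancel₀ _ (two_ne_zero' ℝ)] at h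
  · rw [hQ, mul_div_cancel₀ _ (two_ne_zero' ℝ)]
    exact hq.trans (level_le_tiltedMarg (by linarith) t y)

end TwoSymbol

/-! ### Flipping one label between two classes -/

section Flip

variable {τ ℓ : ℕ} {a b : Fin τ}

/-- The uniform distribution on two classes. -/
noncomputable def pairPrior (a b c : Fin τ) : ℝ := (if c = a then 1 / 2 else 0) + if c = b then 1 / 2 else 0

theorem pairPrior_mem (a b : Fin τ) : pairPrior a b ∈ stdSimplex ℝ (Fin τ) := by
  refine ⟨fun c => by unfold pairPrior; positivity, ?_⟩
  unfold pairPrior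
  rw [sum_add_distrib, sum_ite_eq' univ a fun _ => (1 / 2 : ℝ),
    sum_ite_eq' univ b fun _ => (1 / 2 : ℝ)]
  simp only [mem_univ, if_true]
  norm_num

theorem pairPrior_swap (a b c : Fin τ) : pairPrior a b (Equiv.swap a b c) = pairPrior a b c := by
  unfold pairPrior
  simp only [Equiv.swap_apply_eq_iff, Equiv.swap_apply_left, Equiv.swap_apply_right]
  exact add_comm _ _

/-- The label vector in which the label of object `i` is switched between `a` and `b`. -/
noncomputable def flipLabel (a b : Fin τ) (i : Fin ℓ) (t : Fin ℓ → Fin τ) : Fin ℓ → Fin τ :=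
  Function.update t i (Equiv.swap a b (t i))

theorem flipLabel_same (i : Fin ℓ) (t : Fin ℓ → Fin τ) :
    flipLabel a b i t i = Equiv.swap a b (t i) := by
  simp [flipLabel]

theorem flipLabel_of_ne {i k : Fin ℓ} (h : k ≠ i) (t : Fin ℓ → Fin τ) :
    flipLabel a b i t k = t k := by
  simp [flipLabel, h]

theorem flipLabel_involutive (i : Fin ℓ) :
    Function.Involutive (flipLabel a b i : (Fin ℓ → Fin τ) → _) := by
  intro t
  simp [flipLabel]

theorem sum_flipLabel (i : Fin ℓ) (F : (Fin ℓ → Fin τ) → ℝ) :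
    ∑ t, F (flipLabel a b i t) = ∑ t, F t :=
  Equiv.sum_comp (flipLabel_involutive i).toPerm F

theorem prod_pairPrior_flipLabel (i : Fin ℓ) (t : Fin ℓ → Fin τ) :
    ∏ k, pairPrior a b (flipLabel a b i t k) = ∏ k, pairPrior a b (t k) := by
  refine prod_congr rfl fun k _ => ?_
  by_cases h : k = i
  · subst h; rw [flipLabel_same, pairPrior_swap]
  · rw [flipLabel_of_ne h]

theorem prod_pairPrior_nonneg (t : Fin ℓ → Fin τ) : 0 ≤ ∏ k, pairPrior a b (t k) :=
  prod_nonneg fun _ _ => (pairPrior_mem a b).1 _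

theorem sum_prod_pairPrior : ∑ t : Fin ℓ → Fin τ, ∏ k, pairPrior a b (t k) = 1 := by
  rw [← Fintype.sum_pow, (pairPrior_mem a b).2, one_pow]

theorem eq_or_eq_of_prod_pairPrior_ne_zero {t : Fin ℓ → Fin τ}
    (h : ∏ k, pairPrior a b (t k) ≠ 0) (k : Fin ℓ) : t k = a ∨ t k = b := by
  by_contra hk
  push Not at hk
  exact h (prod_eq_zero (mem_univ k) (by simp [pairPrior, hk.1, hk.2]))

theorem swap_ne_iff (hab : a ≠ b) {c d : Fin τ} (hc : c = a ∨ c = b) (hd : d = a ∨ d = b) :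
    Equiv.swap a b c = d ↔ c ≠ d := by
  rcases hc with rfl | rfl <;> rcases hd with rfl | rfl <;> simp [hab, hab.symm]

theorem correctClustering_flipLabel_ne (hab : a ≠ b) {t : Fin ℓ → Fin τ}
    (ht : ∀ k, t k = a ∨ t k = b) {i k : Fin ℓ} (hki : k ≠ i) :
    correctClustering (flipLabel a b i t) ≠ correctClustering t := by
  intro h
  have h1 : flipLabel a b i t i = flipLabel a b i t k ↔ t i = t k := by
    rw [← Setoid.ker_def, ← Setoid.ker_def (f := t)]
    exact iff_of_eq (congrArg (fun s : Setoid (Fin ℓ) => s i k) h)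
  rw [flipLabel_same, flipLabel_of_ne hki, swap_ne_iff hab (ht i) (ht k)] at h1
  exact (iff_not_self h1.symm)

theorem correctClustering_flipLabel_injective (hab : a ≠ b) (hℓ : 3 ≤ ℓ) {t : Fin ℓ → Fin τ}
    (ht : ∀ k, t k = a ∨ t k = b) {i j : Fin ℓ}
    (h : correctClustering (flipLabel a b i t) = correctClustering (flipLabel a b j t)) :
    i = j := by
  by_contra hij
  obtain ⟨k, hk⟩ : ∃ k, k ∉ ({i, j} : Finset (Fin ℓ)) := by
    by_contra hall
    push Not at hall
    have h1 := card_le_card (fun x _ => hall x : (univ : Finset (Fin ℓ)) ⊆ {i, j})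
    have h2 := card_le_two (a := i) (b := j)
    rw [card_univ, Fintype.card_fin] at h1
    omega
  simp only [mem_insert, mem_singleton, not_or] at hk
  have h1 : flipLabel a b i t i = flipLabel a b i t k ↔
      flipLabel a b j t i = flipLabel a b j t k := by
    rw [← Setoid.ker_def, ← Setoid.ker_def (f := flipLabel a b j t)]
    exact iff_of_eq (congrArg (fun s : Setoid (Fin ℓ) => s i k) h)
  rw [flipLabel_same, flipLabel_of_ne hk.1, flipLabel_of_ne hk.2, flipLabel_of_ne hij,
    swap_ne_iff hab (ht i) (ht k)] at h1
  exact (iff_not_self h1.symm)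

/-! ### The law of a noisy worker under a flip -/

theorem sameIdx_flipLabel_of_eq_some {t : Fin ℓ → Fin τ} {i k m : Fin ℓ} (hki : k ≠ i)
    (h1 : sameIdx t k ≠ some i) (h2 : sameIdx (flipLabel a b i t) k ≠ some i)
    (hm : sameIdx t k = some m) : sameIdx (flipLabel a b i t) k = some m := by
  have hmi : m ≠ i := fun h => h1 (h ▸ hm)
  obtain ⟨⟨hmk, htm⟩, hmax⟩ := sameIdx_eq_some_iff.1 hm
  rw [sameIdx_eq_some_iff, flipLabel_of_ne hmi, flipLabel_of_ne hki]
  refine ⟨⟨hmk, htm⟩, fun m' hm' ht' => ?_⟩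
  by_cases hi : m' = i
  · subst hi
    by_contra hlt
    refine h2 (sameIdx_eq_some_iff.2 ⟨⟨hm', ?_⟩, fun m'' hm'' ht'' => ?_⟩)
    · rw [ht', flipLabel_of_ne hki]
    · by_cases hi : m'' = m'
      · exact hi.le
      · rw [flipLabel_of_ne hi, flipLabel_of_ne hki] at ht''
        exact (hmax m'' hm'' ht'').trans (not_le.1 hlt).le
  · rw [flipLabel_of_ne hi] at ht'
    exact hmax m' hm' ht'

theorem sameIdx_flipLabel {t : Fin ℓ → Fin τ} {i k : Fin ℓ} (hki : k ≠ i)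
    (h1 : sameIdx t k ≠ some i) (h2 : sameIdx (flipLabel a b i t) k ≠ some i) :
    sameIdx (flipLabel a b i t) k = sameIdx t k := by
  refine Option.ext fun m => ⟨fun h => ?_, sameIdx_flipLabel_of_eq_some hki h1 h2⟩
  have := sameIdx_flipLabel_of_eq_some (a := a) (b := b) hki h2
    (by rwa [flipLabel_involutive i t]) h
  rwa [flipLabel_involutive i t] at this

theorem card_filter_sameIdx_le (t : Fin ℓ → Fin τ) (i : Fin ℓ) :
    (univ.filter fun k => sameIdx t k = some i).card ≤ 1 := by
  have key : ∀ k k', sameIdx t k = some i → sameIdx t k' = some i → ¬ k < k' := by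
    intro k k' h h' hlt
    have h1 := sameIdx_eq_some_iff.1 h
    have h2 := sameIdx_eq_some_iff.1 h'
    exact (h2.2 k hlt (h1.1.2.symm.trans h2.1.2)).not_gt h1.1.1
  refine card_le_one.2 fun k hk k' hk' => ?_
  simp only [mem_filter, mem_univ, true_and] at hk hk'
  exact le_antisymm (not_lt.1 (key _ _ hk' hk)) (not_lt.1 (key _ _ hk hk'))

/-- A flip affects at most three factors of the law of a worker: the one at the flipped object, and
those at the next objects of the old and of the new class. -/
theorem pow_three_mul_markovLaw_le
    {K : Option (Response τ) → Option (Response τ) → Fin τ → Response τ → ℝ}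
    (hK : ∀ p s t, K p s t ∈ stdSimplex ℝ (Response τ)) {κ : ℝ} (hκ : 0 ≤ κ) (hκ1 : κ ≤ 1)
    {S : Finset (Response τ)}
    (hS : ∀ p s : Option (Response τ), (∀ y ∈ p, y ∈ S) → (∀ y ∈ s, y ∈ S) →
      ∀ t, (t = a ∨ t = b) → ∀ y, (y ∈ S → κ ≤ K p s t y) ∧ (y ∉ S → K p s t y = 0))
    {t : Fin ℓ → Fin τ} (ht : ∀ k, t k = a ∨ t k = b) (i : Fin ℓ) (y : Fin ℓ → Response τ) :
    κ ^ 3 * markovLaw K t y ≤ markovLaw K (flipLabel a b i t) y := by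
  have hK1 : ∀ p s t y, K p s t y ≤ 1 := fun p s t y =>
    (single_le_sum (fun z _ => (hK p s t).1 z) (mem_univ y)).trans (hK p s t).2.le
  by_cases hy : ∀ k, y k ∈ S
  swap
  · -- the first answer outside `S` has conditional probability zero
    push Not at hy
    obtain ⟨k, hk, hmin⟩ := WellFounded.has_min (wellFounded_lt (α := Fin ℓ)) {k | y k ∉ S} hy
    have hlt : ∀ m < k, y m ∈ S := fun m hm => by
      by_contra h
      exact hmin m h hm
    have : markovLaw K t y = 0 := by
      refine prod_eq_zero (mem_univ k) ((hS _ _ ?_ ?_ _ (ht k) _).2 hk)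
      · intro z hz
        obtain ⟨m, hm, rfl⟩ := Option.mem_map.1 hz
        exact hlt m (prevIdx_eq_some_iff.1 hm).1
      · intro z hz
        obtain ⟨m, hm, rfl⟩ := Option.mem_map.1 hz
        exact hlt m (sameIdx_eq_some_iff.1 hm).1.1
    rw [this, mul_zero]
    exact markovLaw_nonneg (fun p s t => (hK p s t).1) _ _
  have hmem : ∀ o : Option (Fin ℓ), ∀ z ∈ o.map y, z ∈ S := by
    intro o z hz
    obtain ⟨m, -, rfl⟩ := Option.mem_map.1 hz
    exact hy m
  have ht' : ∀ k, flipLabel a b i t k = a ∨ flipLabel a b i t k = b := by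
    intro k
    by_cases h : k = i
    · subst h
      rw [flipLabel_same]
      rcases ht k with h | h <;> simp [h]
    · rw [flipLabel_of_ne h]; exact ht k
  set B : Finset (Fin ℓ) := ({i} ∪ univ.filter fun k => sameIdx t k = some i) ∪
    univ.filter fun k => sameIdx (flipLabel a b i t) k = some i with hB
  have hBcard : B.card ≤ 3 := by
    refine (card_union_le _ _).trans ?_
    have h1 := card_union_le {i} (univ.filter fun k => sameIdx t k = some i)
    have h2 := card_filter_sameIdx_le t i
    have h3 := card_filter_sameIdx_le (flipLabel a b i t) i
    rw [card_singleton] at h1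
    omega
  calc κ ^ 3 * markovLaw K t y ≤ κ ^ B.card * markovLaw K t y := by
        refine mul_le_mul_of_nonneg_right (pow_le_pow_of_le_one hκ hκ1 hBcard) ?_
        exact markovLaw_nonneg (fun p s t => (hK p s t).1) _ _
    _ = ∏ k, ((if k ∈ B then κ else 1) *
          K ((prevIdx k).map y) ((sameIdx t k).map y) (t k) (y k)) := by
        rw [prod_mul_distrib, prod_ite_mem, univ_inter, prod_const, markovLaw]
    _ ≤ _ := by
        refine prod_le_prod (fun k _ => mul_nonneg (by positivity) ((hK _ _ _).1 _))
          fun k _ => ?_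
        by_cases hk : k ∈ B
        · rw [if_pos hk]
          exact (mul_le_of_le_one_right hκ (hK1 _ _ _ _)).trans
            ((hS _ _ (hmem _) (hmem _) _ (ht' k) _).1 (hy k))
        · rw [if_neg hk, one_mul]
          simp only [hB, mem_union, mem_singleton, mem_filter, mem_univ, true_and, not_or] at hk
          rw [sameIdx_flipLabel hk.1.1 hk.1.2 hk.2, flipLabel_of_ne hk.1.1]

theorem WorkerPool.law_nonneg (R : WorkerPool τ ℓ) (t : Fin ℓ → Fin τ) (y : Fin ℓ → Response τ) :
    0 ≤ R.law t y :=
  sum_nonneg fun w _ => mul_nonneg (R.weight_mem.1 w)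
    (markovLaw_nonneg (fun p s t => ((R.worker w).kernel_mem p s t).1) t y)

theorem WorkerPool.sum_law (R : WorkerPool τ ℓ) (t : Fin ℓ → Fin τ) : ∑ y, R.law t y = 1 := by
  unfold WorkerPool.law
  rw [sum_comm]
  simp only [← mul_sum, sum_markovLaw fun p s t => ((R.worker _).kernel_mem p s t).2, mul_one]
  exact R.weight_mem.2

/-! ### Lower bounds on the error probability -/

/-- The responses to all objects are a list of `n` independent response vectors. -/
theorem sum_matrix {n : ℕ} (F : (Fin n → Fin ℓ → Response τ) → ℝ) :
    ∑ Y : Fin ℓ → Fin n → Response τ, F (fun j i => Y i j) = ∑ Z, F Z :=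
  (Equiv.piComm fun (_ : Fin ℓ) (_ : Fin n) => Response τ).sum_comp F

theorem WorkerPool.sum_prod_law (R : WorkerPool τ ℓ) (t : Fin ℓ → Fin τ) (n : ℕ) :
    ∑ Y : Fin ℓ → Fin n → Response τ, ∏ j, R.law t (fun i => Y i j) = 1 := by
  rw [sum_matrix fun Z => ∏ j, R.law t (Z j), ← Fintype.sum_pow, R.sum_law, one_pow]

open Classical in
/-- If flipping a label lowers likelihoods at most by a factor `δ`, then a correctly decoded
label vector competes with its `ℓ` flips, which are decoded wrongly, and a wrongly decoded vector
is a flip of at most one correctly decoded vector. -/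
theorem mul_one_sub_errorProb_le (hab : a ≠ b) (hℓ : 3 ≤ ℓ) {n : ℕ} (Φ : Decoder τ ℓ n)
    (R : WorkerPool τ ℓ) {δ : ℝ}
    (hδ : ∀ t : Fin ℓ → Fin τ, (∀ k, t k = a ∨ t k = b) → ∀ i (Y : Fin ℓ → Fin n → Response τ),
      δ * ∏ j, R.law t (fun i => Y i j) ≤ ∏ j, R.law (flipLabel a b i t) (fun i => Y i j)) :
    ℓ * δ * (1 - errorProb Φ (pairPrior a b) R) ≤ errorProb Φ (pairPrior a b) R := by
  set F : (Fin ℓ → Fin τ) → (Fin ℓ → Fin n → Response τ) → ℝ :=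
    fun t Y => ∏ j, R.law t (fun i => Y i j) with hF
  have hF0 : ∀ t Y, 0 ≤ F t Y := fun t Y => prod_nonneg fun j _ => R.law_nonneg t _
  set S : (Fin ℓ → Fin τ) → (Fin ℓ → Fin n → Response τ) → ℝ :=
    fun t Y => if Φ Y = correctClustering t then 1 else 0 with hS
  set W : (Fin ℓ → Fin τ) → ℝ := fun t => ∏ k, pairPrior a b (t k) with hW
  have hW0 : ∀ t, 0 ≤ W t := prod_pairPrior_nonneg
  have hS0 : ∀ t Y, 0 ≤ S t Y := fun t Y => by simp only [hS]; positivity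
  have hE : errorProb Φ (pairPrior a b) R = ∑ t, W t * ∑ Y, F t Y * (1 - S t Y) := by
    unfold errorProb
    refine sum_congr rfl fun t _ => ?_
    congr 1
    refine sum_congr rfl fun Y _ => ?_
    simp only [hS, hF]
    congr 1
    by_cases h : Φ Y = correctClustering t <;> simp [h]
  have hsucc : 1 - errorProb Φ (pairPrior a b) R = ∑ t, W t * ∑ Y, F t Y * S t Y := by
    have h1 : ∑ t, W t * ∑ Y, F t Y = 1 := by
      simp only [hF, R.sum_prod_law, mul_one]
      exact sum_prod_pairPrior
    refine Eq.trans (congrArg₂ _ h1.symm hE) ?_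
    rw [← sum_sub_distrib]
    refine sum_congr rfl fun t _ => ?_
    rw [← mul_sub, ← sum_sub_distrib]
    congr 1
    exact sum_congr rfl fun Y _ => by ring
  rw [hsucc]
  calc ℓ * δ * ∑ t, W t * ∑ Y, F t Y * S t Y
      = ∑ i : Fin ℓ, ∑ t, W t * ∑ Y, (δ * F t Y) * S t Y := by
        rw [sum_const, card_univ, Fintype.card_fin, nsmul_eq_mul, mul_assoc, mul_sum]
        congr 1
        refine sum_congr rfl fun t _ => ?_
        rw [mul_left_comm, mul_sum]
        congr 1
        exact sum_congr rfl fun Y _ => by ring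
    _ ≤ ∑ i : Fin ℓ, ∑ t, W (flipLabel a b i t) * ∑ Y, F (flipLabel a b i t) Y *
          S (flipLabel a b i (flipLabel a b i t)) Y := by
        refine sum_le_sum fun i _ => sum_le_sum fun t _ => ?_
        rw [flipLabel_involutive i t]
        simp only [hW, prod_pairPrior_flipLabel]
        by_cases h0 : ∏ k, pairPrior a b (t k) = 0
        · rw [h0, zero_mul, zero_mul]
        · refine mul_le_mul_of_nonneg_left (sum_le_sum fun Y _ => ?_) (prod_pairPrior_nonneg t)
          exact mul_le_mul_of_nonneg_right
            (hδ t (eq_or_eq_of_prod_pairPrior_ne_zero h0) i Y) (hS0 t Y)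
    _ = ∑ i : Fin ℓ, ∑ t, W t * ∑ Y, F t Y * S (flipLabel a b i t) Y :=
        sum_congr rfl fun i _ =>
          sum_flipLabel i fun t => W t * ∑ Y, F t Y * S (flipLabel a b i t) Y
    _ = ∑ t, W t * ∑ Y, F t Y * ∑ i, S (flipLabel a b i t) Y := by
        rw [sum_comm]
        refine sum_congr rfl fun t _ => ?_
        rw [← mul_sum, sum_comm]
        simp only [mul_sum]
    _ ≤ ∑ t, W t * ∑ Y, F t Y * (1 - S t Y) := by
        refine sum_le_sum fun t _ => ?_
        by_cases h0 : W t = 0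
        · rw [h0, zero_mul, zero_mul]
        have ht := eq_or_eq_of_prod_pairPrior_ne_zero h0
        refine mul_le_mul_of_nonneg_left (sum_le_sum fun Y _ => ?_) (hW0 t)
        refine mul_le_mul_of_nonneg_left ?_ (hF0 t Y)
        simp only [hS]
        rw [sum_boole]
        by_cases hY : Φ Y = correctClustering t
        · rw [if_pos hY, filter_false_of_mem, card_empty]
          · norm_num
          intro i _ hi
          obtain ⟨k, hk⟩ : ∃ k, k ≠ i := by
            have : Nontrivial (Fin ℓ) := Fin.nontrivial_iff_two_le.2 (by omega)
            exact exists_ne i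
          exact correctClustering_flipLabel_ne hab ht hk (hi.symm.trans hY)
        · rw [if_neg hY, sub_zero]
          norm_cast
          refine card_le_one.2 fun i hi j hj => ?_
          simp only [mem_filter, mem_univ, true_and] at hi hj
          exact correctClustering_flipLabel_injective hab hℓ ht (hi.symm.trans hj)
    _ = errorProb Φ (pairPrior a b) R := hE.symm

open Classical in
/-- If the responses have nearly the same law `G` for all label vectors, then decoding is no better
than guessing: a label vector and its flip are not both decoded correctly. -/
theorem half_sub_le_errorProb (hab : a ≠ b) (hℓ : 2 ≤ ℓ) {n : ℕ} (Φ : Decoder τ ℓ n)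
    (R : WorkerPool τ ℓ) (G : (Fin ℓ → Fin n → Response τ) → ℝ) (hG0 : ∀ Y, 0 ≤ G Y)
    (hG : ∑ Y, G Y = 1) {η : ℝ}
    (hη : ∀ t, ∑ Y : Fin ℓ → Fin n → Response τ, |∏ j, R.law t (fun i => Y i j) - G Y| ≤ η) :
    1 / 2 - η ≤ errorProb Φ (pairPrior a b) R := by
  set E : (Fin ℓ → Fin τ) → (Fin ℓ → Fin n → Response τ) → ℝ :=
    fun t Y => if Φ Y ≠ correctClustering t then 1 else 0 with hE
  set W : (Fin ℓ → Fin τ) → ℝ := fun t => ∏ k, pairPrior a b (t k) with hW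
  have hW0 : ∀ t, 0 ≤ W t := prod_pairPrior_nonneg
  have hW1 : ∑ t, W t = 1 := sum_prod_pairPrior
  let i : Fin ℓ := ⟨0, by omega⟩
  let k : Fin ℓ := ⟨1, hℓ⟩
  have hki : k ≠ i := by simp [k, i]
  have hguess : 1 ≤ 2 * ∑ t, W t * ∑ Y, G Y * E t Y := by
    calc (1 : ℝ) = ∑ t, W t * ∑ Y, G Y := by rw [hG]; simp [hW1]
      _ ≤ ∑ t, W t * ∑ Y, G Y * (E t Y + E (flipLabel a b i t) Y) := by
          refine sum_le_sum fun t _ => ?_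
          by_cases h0 : W t = 0
          · rw [h0, zero_mul, zero_mul]
          have ht := eq_or_eq_of_prod_pairPrior_ne_zero h0
          refine mul_le_mul_of_nonneg_left (sum_le_sum fun Y _ => ?_) (hW0 t)
          refine le_mul_of_one_le_right (hG0 Y) ?_
          have hne := correctClustering_flipLabel_ne hab ht hki
          by_cases h1 : Φ Y = correctClustering t
          · have h2 : Φ Y ≠ correctClustering (flipLabel a b i t) :=
              fun h => hne (h.symm.trans h1)
            simp only [hE, h1, ne_eq, not_true_eq_false, if_false]
            rw [if_pos (h1 ▸ h2), zero_add]
          · simp only [hE, ne_eq, h1, not_false_eq_true, if_true]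
            exact le_add_of_nonneg_right (by positivity)
      _ = ∑ t, W t * ∑ Y, G Y * E t Y +
            ∑ t, W (flipLabel a b i t) * ∑ Y, G Y * E (flipLabel a b i t) Y := by
          rw [← sum_add_distrib]
          refine sum_congr rfl fun t _ => ?_
          simp only [hW, prod_pairPrior_flipLabel]
          rw [← mul_add, ← sum_add_distrib]
          simp only [mul_add]
      _ = 2 * ∑ t, W t * ∑ Y, G Y * E t Y := by
          rw [sum_flipLabel i fun t => W t * ∑ Y, G Y * E t Y]; ring
  calc 1 / 2 - η ≤ ∑ t, W t * ∑ Y, G Y * E t Y - η := by linarith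
    _ = ∑ t, W t * (∑ Y, G Y * E t Y - η) := by
        simp only [mul_sub, sum_sub_distrib, ← sum_mul, hW1, one_mul]
    _ ≤ errorProb Φ (pairPrior a b) R := by
        unfold errorProb
        refine sum_le_sum fun t _ => mul_le_mul_of_nonneg_left ?_ (hW0 t)
        rw [sub_le_comm, ← sum_sub_distrib]
        refine le_trans (sum_le_sum fun Y _ => ?_) (hη t)
        rw [← sub_mul]
        refine le_trans (mul_le_mul_of_nonneg_right
          ((le_abs_self _).trans (abs_sub_comm _ _).le) (by simp only [hE]; positivity)) ?_
        refine mul_le_of_le_one_right (abs_nonneg _) ?_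
        simp only [hE]
        split_ifs <;> norm_num

end Flip

/-! ### Many objects -/

theorem WorkerPool.pow_mul_prod_law_le {τ ℓ n : ℕ} (R : WorkerPool τ ℓ) {a b : Fin τ} {κ : ℝ}
    (hκ : 0 ≤ κ) (hκ1 : κ ≤ 1)
    (hR : ∀ w, ∃ S : Finset (Response τ),
      ∀ p s : Option (Response τ), (∀ y ∈ p, y ∈ S) → (∀ y ∈ s, y ∈ S) →
        ∀ t, (t = a ∨ t = b) → ∀ y,
          (y ∈ S → κ ≤ (R.worker w).kernel p s t y) ∧
          (y ∉ S → (R.worker w).kernel p s t y = 0))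
    {t : Fin ℓ → Fin τ} (ht : ∀ k, t k = a ∨ t k = b) (i : Fin ℓ)
    (Y : Fin ℓ → Fin n → Response τ) :
    (κ ^ 3) ^ n * ∏ j, R.law t (fun i => Y i j) ≤
      ∏ j, R.law (flipLabel a b i t) (fun i => Y i j) := by
  calc (κ ^ 3) ^ n * ∏ j, R.law t (fun i => Y i j)
      = ∏ j, κ ^ 3 * R.law t (fun i => Y i j) := by
        rw [prod_mul_distrib, prod_const, card_univ, Fintype.card_fin]
    _ ≤ _ := by
        refine prod_le_prod (fun j _ => mul_nonneg (by positivity) (R.law_nonneg _ _))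
          fun j _ => ?_
        unfold WorkerPool.law
        rw [mul_sum]
        refine sum_le_sum fun w _ => ?_
        rw [mul_left_comm]
        obtain ⟨S, hS⟩ := hR w
        exact mul_le_mul_of_nonneg_left
          (pow_three_mul_markovLaw_le (R.worker w).kernel_mem hκ hκ1 hS ht i _)
          (R.weight_mem.1 w)

/-- With fewer than `log ℓ / (3 log (1 / κ))` workers, the likelihood ratio `κ ^ (3 n)` of a flip
is larger than `1 / ℓ`, so that the flips outweigh the correct label vector. -/
theorem log_le_of_solvable {τ ℓ n : ℕ} (hℓ : 3 ≤ ℓ) {ε θm θd κ : ℝ} (hε : ε ≤ 1 / 4)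
    (hκ : 0 < κ) (R : WorkerPool τ ℓ) (hq : R.HasQuality θm θd) (hR : R.IsNoisy κ)
    (hn : Solvable τ ℓ n ε θm θd) :
    1 / (3 * Real.log (1 / min κ (1 / 2))) * Real.log ℓ ≤ n := by
  obtain ⟨Φ, hΦ⟩ := hn
  obtain ⟨a, b, hab, hR⟩ := hR
  -- capping the noise level at `1 / 2` makes the logarithm positive
  set κ' := min κ (1 / 2) with hκ'
  have h0 : 0 < κ' := lt_min hκ (by norm_num)
  have h1 : κ' ≤ 1 / 2 := min_le_right _ _
  have hlog : 0 < Real.log (1 / κ') := Real.log_pos (by rw [lt_div_iff₀ h0]; linarith)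
  have hE := hΦ _ (pairPrior_mem a b) R hq
  have hmain := mul_one_sub_errorProb_le hab hℓ Φ R (δ := (κ' ^ 3) ^ n)
    fun t ht i Y => R.pow_mul_prod_law_le h0.le (by linarith) (fun w => by
      obtain ⟨S, hS⟩ := hR w
      exact ⟨S, fun p s hp hs t ht y => ⟨fun hy => (min_le_left _ _).trans
        ((hS p s hp hs t ht y).1 hy), (hS p s hp hs t ht y).2⟩⟩) ht i Y
  by_contra! hlt
  have hℓ0 : (0 : ℝ) < ℓ := by exact_mod_cast (by omega : 0 < ℓ)
  have hδ : 1 ≤ (ℓ : ℝ) * (κ' ^ 3) ^ n := by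
    rw [← Real.log_nonneg_iff (by positivity), Real.log_mul hℓ0.ne' (by positivity), Real.log_pow,
      Real.log_pow]
    rw [one_div, inv_mul_eq_div, lt_div_iff₀ (by linarith), one_div, Real.log_inv] at hlt
    push_cast
    linarith
  nlinarith

/-! ### Few objects -/

theorem sum_uniform_pow {α : Type} [Fintype α] [Nonempty α] (n : ℕ) :
    ∑ _Z : Fin n → α, ((1 / Fintype.card α) ^ n : ℝ) = 1 := by
  have h : (Fintype.card α : ℝ) ≠ 0 := by exact_mod_cast Fintype.card_ne_zero
  rw [sum_const, card_univ, Fintype.card_fun, Fintype.card_fin, nsmul_eq_mul, Nat.cast_pow,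
    ← mul_pow, mul_one_div_cancel h, one_pow]

/-- A law on a finite type whose density with respect to the uniform distribution is within `ρ` of
`1` has nearly uniform powers: the second moment of the density is multiplicative. -/
theorem sq_sum_abs_prod_sub_le {α : Type} [Fintype α] [Nonempty α] (p : α → ℝ)
    (hp : ∑ x, p x = 1) {ρ : ℝ} (hρ : ∀ x, |Fintype.card α * p x - 1| ≤ ρ) (n : ℕ) :
    (∑ Z : Fin n → α, |∏ j, p (Z j) - (1 / Fintype.card α) ^ n|) ^ 2 ≤ (1 + ρ ^ 2) ^ n - 1 := by
  set N : ℝ := (Fintype.card α : ℝ) with hN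
  have hN0 : 0 < N := by rw [hN]; exact_mod_cast Fintype.card_pos
  have h1 : N * ∑ x, p x ^ 2 ≤ 1 + ρ ^ 2 := by
    have h2 : ∑ x, (N * p x - 1) ^ 2 ≤ ∑ _x : α, ρ ^ 2 :=
      sum_le_sum fun x _ => sq_le_sq' (by linarith [(abs_le.1 (hρ x)).1]) (abs_le.1 (hρ x)).2
    have h3 : ∑ x, (N * p x - 1) ^ 2 = N ^ 2 * ∑ x, p x ^ 2 - 2 * N * ∑ x, p x + N := by
      have : N = ∑ _x : α, (1 : ℝ) := by simp [hN]
      conv_rhs => rw [mul_sum, mul_sum, ← sum_sub_distrib]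
      conv_rhs => rw [this]
      rw [← sum_add_distrib]
      exact sum_congr rfl fun x _ => by rw [← this]; ring
    rw [h3, hp, sum_const, card_univ, nsmul_eq_mul] at h2
    have : N * (N * ∑ x, p x ^ 2) ≤ N * (1 + ρ ^ 2) := by linarith
    exact le_of_mul_le_mul_left this hN0
  have hcard : (Fintype.card (Fin n → α) : ℝ) = N ^ n := by
    rw [Fintype.card_fun, Fintype.card_fin]; push_cast; rfl
  have hcs := sq_sum_le_card_mul_sum_sq (s := (univ : Finset (Fin n → α)))
    (f := fun Z => |∏ j, p (Z j) - (1 / N) ^ n|)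
  refine hcs.trans ?_
  rw [card_univ, hcard]
  have hexp : ∑ Z : Fin n → α, |∏ j, p (Z j) - (1 / N) ^ n| ^ 2 =
      (∑ x, p x ^ 2) ^ n - (1 / N) ^ n := by
    have h4 : ∀ Z : Fin n → α, |∏ j, p (Z j) - (1 / N) ^ n| ^ 2 =
        ∏ j, p (Z j) ^ 2 - 2 * (1 / N) ^ n * ∏ j, p (Z j) + ((1 / N) ^ n) ^ 2 := by
      intro Z
      rw [sq_abs, prod_pow]
      ring
    simp only [h4]
    rw [sum_add_distrib, sum_sub_distrib, ← mul_sum, ← Fintype.sum_pow, hp,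
      ← Fintype.sum_pow (fun x => p x ^ 2), sum_const, card_univ, nsmul_eq_mul, hcard]
    have : N ^ n * (1 / N) ^ n = 1 := by rw [← mul_pow, mul_one_div_cancel hN0.ne', one_pow]
    linear_combination (1 / N) ^ n * this
  rw [hexp, mul_sub, ← mul_pow, ← mul_pow, mul_one_div_cancel hN0.ne', one_pow]
  have : 0 ≤ N * ∑ x, p x ^ 2 := by positivity
  gcongr

/-- If the density of the responses of a worker is within `ρ` of `1` for all label vectors, then
about `ρ⁻²` workers are needed. -/
theorem quarter_le_errorProb {τ ℓ n : ℕ} {a b : Fin τ} (hab : a ≠ b) (hℓ : 2 ≤ ℓ)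
    (Φ : Decoder τ ℓ n) (R : WorkerPool τ ℓ) {ρ : ℝ}
    (hρ : ∀ (t : Fin ℓ → Fin τ) (y : Fin ℓ → Response τ),
      |Fintype.card (Fin ℓ → Response τ) * R.law t y - 1| ≤ ρ)
    (hx : n * ρ ^ 2 ≤ 1 / 32) : 1 / 4 ≤ errorProb Φ (pairPrior a b) R := by
  have hclose : ∀ t, ∑ Y : Fin ℓ → Fin n → Response τ, |∏ j, R.law t (fun i => Y i j) -
      (1 / Fintype.card (Fin ℓ → Response τ)) ^ n| ≤ 1 / 4 := by
    intro t
    rw [sum_matrix fun Z => |∏ j, R.law t (Z j) -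
        (1 / Fintype.card (Fin ℓ → Response τ)) ^ n|]
    have h := sq_sum_abs_prod_sub_le _ (R.sum_law t) (hρ t) n
    refine le_of_sq_le_sq (h.trans ?_) (by norm_num)
    have h1 : (1 + ρ ^ 2) ^ n ≤ Real.exp (n * ρ ^ 2) := by
      rw [Real.exp_nat_mul]
      gcongr
      linarith [Real.add_one_le_exp (ρ ^ 2)]
    have h2 : Real.exp (n * ρ ^ 2) ≤ 17 / 16 := by
      refine (Real.exp_le_exp.2 hx).trans ?_
      have h3 := Real.add_one_le_exp (-(1 / 32 : ℝ))
      have h4 : Real.exp (-(1 / 32 : ℝ)) * Real.exp (1 / 32) = 1 := by rw [← Real.exp_add]; simp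
      nlinarith [Real.exp_pos (1 / 32 : ℝ)]
    linarith
  have h := half_sub_le_errorProb hab hℓ Φ R
    (fun _ => (1 / Fintype.card (Fin ℓ → Response τ)) ^ n) (fun _ => by positivity)
    (by rw [sum_matrix fun _ => ((1 / Fintype.card (Fin ℓ → Response τ)) ^ n : ℝ),
      sum_uniform_pow]) hclose
  linarith

/-- The density of a worker with weakly informative answers and weak memory is close to `1`. -/
theorem StepMemory.abs_card_mul_law_sub_one_le {τ : ℕ} (σ : StepMemory τ) {ℓ : ℕ} {r M : ℝ}
    (hr : 0 ≤ r) (hr1 : r ≤ 1) (hQ : σ.Q = tiltedMarg τ r)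
    (hM : ∀ t y s, τ * r + (τ + 1) * |σ.w t y * σ.u t s| ≤ M)
    (hM0 : τ * r ≤ M) (t : Fin ℓ → Fin τ) (y : Fin ℓ → Response τ) :
    |Fintype.card (Fin ℓ → Response τ) * markovLaw σ.kernel t y - 1| ≤
      ℓ * M * Real.exp (ℓ * M) := by
  have hM1 : 0 ≤ M := le_trans (by positivity) hM0
  have hcard : (Fintype.card (Fin ℓ → Response τ) : ℝ) = ∏ _i : Fin ℓ, ((τ : ℝ) + 1) := by
    rw [Fintype.card_fun, Fintype.card_option, Fintype.card_fin, Fintype.card_fin]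
    simp
  have hfac : ∀ s t y, |((τ : ℝ) + 1) * σ.kernel none s t y - 1| ≤ M := by
    intro s t y
    have hind : |(τ + 1) * tiltedMarg τ r t y - 1| ≤ τ * r := by
      have h1 : ((τ : ℝ) + 1) * ((1 - r) / (τ + 1)) = 1 - r := by field_simp
      have hτ : (1 : ℝ) ≤ τ := by exact_mod_cast t.pos
      unfold tiltedMarg
      rw [mul_add, h1, abs_le]
      split_ifs <;> constructor <;> nlinarith
    have hle : |(τ + 1) * tiltedMarg τ r t y| ≤ τ + 1 := by
      have h2 := abs_le.1 hind
      have hτ : (τ : ℝ) * r ≤ τ := mul_le_of_le_one_right (by positivity) hr1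
      rw [abs_of_nonneg]
      · linarith
      · have h3 : 0 < σ.Q t y := σ.Q_pos t y
        rw [hQ] at h3
        positivity
    have hmem : τ * r + (τ + 1) * |σ.w t y * σ.mem s t| ≤ M := by
      cases s with
      | none => simpa [mem] using hM0
      | some s => exact hM t y s
    refine le_trans ?_ hmem
    calc _ = |((τ + 1) * tiltedMarg τ r t y - 1) +
          (τ + 1) * tiltedMarg τ r t y * (σ.w t y * σ.mem s t)| := by
          rw [kernel, hQ]; congr 1; ring
      _ ≤ _ := (abs_add_le _ _).trans (add_le_add hind (by
          rw [abs_mul]; exact mul_le_mul_of_nonneg_right hle (abs_nonneg _)))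
  have h := Finset.norm_prod_one_add_sub_one_le (univ : Finset (Fin ℓ)) fun i =>
    ((τ : ℝ) + 1) * σ.kernel none ((sameIdx t i).map y) (t i) (y i) - 1
  simp only [add_sub_cancel, prod_mul_distrib, Real.norm_eq_abs] at h
  rw [hcard]
  refine h.trans ?_
  have hsum : ∑ i, |((τ : ℝ) + 1) * σ.kernel none ((sameIdx t i).map y) (t i) (y i) - 1| ≤
      ℓ * M := by
    refine (sum_le_card_nsmul _ _ M fun i _ => hfac _ _ _).trans ?_
    simp
  have hexp : Real.exp (ℓ * M) - 1 ≤ ℓ * M * Real.exp (ℓ * M) := by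
    have h1 := Real.add_one_le_exp (-(ℓ * M))
    have h2 : Real.exp (-(ℓ * M)) * Real.exp (ℓ * M) = 1 := by rw [← Real.exp_add]; simp
    nlinarith [Real.exp_pos (ℓ * M)]
  exact le_trans (by gcongr) hexp

/-- The responses to a fixed number of objects stay nearly uniform as long as the number of workers
is small compared with `(θm + θd ^ 2)⁻¹`. -/
theorem exists_le_mul_of_solvable {τ : ℕ} (hτ : 2 ≤ τ) {ε : ℝ} (hε : ε ≤ 1 / 4) {ℓ : ℕ}
    (hℓ : 2 ≤ ℓ) :
    ∃ c : ℝ, 0 < c ∧ ∀ θm θd : ℝ, 0 ≤ θm → 0 ≤ θd →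
      (∃ R : WorkerPool τ ℓ, R.HasQuality θm θd) →
        ∀ n : ℕ, Solvable τ ℓ n ε θm θd → c ≤ n * (θm + θd ^ 2) := by
  set m : ℝ := (1 / (2 * (τ + 1))) ^ 2 / 96 with hm
  have hm0 : 0 < m := by positivity
  have hm1 : m ≤ 1 := by
    have : 1 / (2 * ((τ : ℝ) + 1)) ≤ 1 := by
      rw [div_le_one (by positivity)]
      linarith [(Nat.cast_nonneg τ : (0 : ℝ) ≤ τ)]
    have h2 : (1 / (2 * ((τ : ℝ) + 1))) ^ 2 ≤ 1 := pow_le_one₀ (by positivity) this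
    linarith
  -- each factor of the density is within `√(A * v)` of `1`, their product within `√(D * v)`,
  -- where `v = θm + θd ^ 2 ≤ 2`
  set A : ℝ := 200 * ((τ : ℝ) + 1) ^ 4 with hA
  set D : ℝ := (ℓ * Real.exp (ℓ * √(2 * A))) ^ 2 * A with hD
  have hℓ0 : (0 : ℝ) < ℓ := by exact_mod_cast (by omega : 0 < ℓ)
  have hA0 : 0 < A := by positivity
  have hD0 : 0 < D := by positivity
  have hab : (⟨0, by omega⟩ : Fin τ) ≠ ⟨1, hτ⟩ := by simp
  refine ⟨min m (1 / (32 * D)), lt_min hm0 (by positivity), fun θm θd h0m h0d ⟨R, hR⟩ n hn => ?_⟩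
  obtain ⟨Φ, hΦ⟩ := hn
  by_cases hsmall : θm ≤ m ∧ θd ≤ 1
  swap
  · -- one worker is needed in any case
    have hn1 : 1 ≤ n := by
      by_contra hn0
      obtain rfl : n = 0 := by omega
      have h1 := half_sub_le_errorProb hab hℓ Φ R (fun _ => 1) (fun _ => zero_le_one)
        (by simp) (η := 0) (fun t => by simp)
      linarith [hΦ _ (pairPrior_mem ⟨0, by omega⟩ ⟨1, hτ⟩) R hR]
    have hn1' : (1 : ℝ) ≤ n := by exact_mod_cast hn1
    have hv : m ≤ θm + θd ^ 2 := by
      rcases not_and_or.1 hsmall with h | h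
      · nlinarith
      · nlinarith
    calc min m (1 / (32 * D)) ≤ m := min_le_left _ _
      _ ≤ θm + θd ^ 2 := hv
      _ ≤ n * (θm + θd ^ 2) := le_mul_of_one_le_left (by positivity) hn1'
  obtain ⟨hs1, hs2⟩ := hsmall
  by_contra! hlt
  have hlt' : n * (θm + θd ^ 2) < 1 / (32 * D) := hlt.trans_le (min_le_right _ _)
  set v : ℝ := θm + θd ^ 2 with hv
  have hv0 : 0 ≤ v := by positivity
  have hv2 : v ≤ 2 := by nlinarith
  have hq : 1 / (2 * ((τ : ℝ) + 1)) ≤ (1 - θd / 2) / (τ + 1) := by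
    rw [div_le_div_iff₀ (by positivity) (by positivity)]
    nlinarith [(Nat.cast_nonneg τ : (0 : ℝ) ≤ τ)]
  obtain ⟨σ, e, hQ, hinfo, he⟩ := exists_stepMemory hτ (r := θd / 2) (θ := θm) (by linarith)
    (by linarith) h0m (hs1.trans (by rw [hm]; gcongr))
  have hqual : (σ.toPool ℓ).HasQuality θm θd := by
    have h := σ.hasQuality hτ hℓ (by linarith) hQ hinfo
    rwa [mul_div_cancel₀ _ (two_ne_zero' ℝ)] at h
  have hbound : ∀ t y s, τ * (θd / 2) + (τ + 1) * |σ.w t y * σ.u t s| ≤ √(A * v) := by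
    intro t y s
    obtain ⟨he0, -, hesq, hwu⟩ := he t
    have he2 : e t ^ 2 ≤ 24 * ((τ : ℝ) + 1) ^ 2 * θm := by
      have h1 : (1 / (2 * ((τ : ℝ) + 1))) ^ 2 * e t ^ 2 ≤ 6 * θm := le_trans (by gcongr) hesq
      rw [div_pow, one_pow, one_div, inv_mul_le_iff₀ (by positivity)] at h1
      linarith
    have hT : (1 : ℝ) ≤ (τ : ℝ) + 1 := by linarith [(Nat.cast_nonneg τ : (0 : ℝ) ≤ τ)]
    refine Real.le_sqrt_of_sq_le ?_
    calc (τ * (θd / 2) + (τ + 1) * |σ.w t y * σ.u t s|) ^ 2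
        ≤ ((τ + 1) * (θd / 2) + (τ + 1) * (2 * e t)) ^ 2 := by
          gcongr
          · linarith
          · exact hwu y s
      _ = (τ + 1) ^ 2 * (θd / 2 + 2 * e t) ^ 2 := by ring
      _ ≤ (τ + 1) ^ 2 * (θd ^ 2 + 8 * e t ^ 2) := by
          gcongr
          nlinarith [sq_nonneg (θd / 2 - 2 * e t)]
      _ ≤ (τ + 1) ^ 2 * (((τ : ℝ) + 1) ^ 2 * θd ^ 2 + 8 * (24 * ((τ : ℝ) + 1) ^ 2 * θm)) := by
          gcongr
          exact le_mul_of_one_le_left (by positivity) (one_le_pow₀ hT)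
      _ = (τ + 1) ^ 4 * (θd ^ 2 + 192 * θm) := by ring
      _ ≤ (τ + 1) ^ 4 * (200 * (θm + θd ^ 2)) := by
          gcongr
          nlinarith
      _ = A * v := by rw [hA, hv]; ring
  have hbound0 : τ * (θd / 2) ≤ √(A * v) := by
    have := hbound ⟨0, by omega⟩ none none
    have h2 : 0 ≤ ((τ : ℝ) + 1) * |σ.w ⟨0, by omega⟩ none * σ.u ⟨0, by omega⟩ none| := by
      positivity
    linarith
  have hρ : ∀ (t : Fin ℓ → Fin τ) (y : Fin ℓ → Response τ),
      |Fintype.card (Fin ℓ → Response τ) * (σ.toPool ℓ).law t y - 1| ≤ √(D * v) := by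
    intro t y
    rw [σ.law_toPool]
    refine (σ.abs_card_mul_law_sub_one_le (by linarith) (by linarith) hQ hbound hbound0 t y).trans ?_
    have h1 : √(A * v) ≤ √(2 * A) := Real.sqrt_le_sqrt (by nlinarith)
    calc ℓ * √(A * v) * Real.exp (ℓ * √(A * v))
        ≤ ℓ * √(A * v) * Real.exp (ℓ * √(2 * A)) := by gcongr
      _ = ℓ * Real.exp (ℓ * √(2 * A)) * √(A * v) := by ring
      _ = √(D * v) := by
          rw [hD, mul_assoc _ A v, Real.sqrt_mul (by positivity) (A * v), Real.sqrt_sq (by positivity)]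
  have hx : n * √(D * v) ^ 2 ≤ 1 / 32 := by
    rw [lt_div_iff₀ (by positivity)] at hlt'
    rw [Real.sq_sqrt (by positivity)]
    linarith
  have hfin := quarter_le_errorProb hab hℓ Φ (σ.toPool ℓ) hρ hx
  linarith [hΦ _ (pairPrior_mem ⟨0, by omega⟩ ⟨1, hτ⟩) (σ.toPool ℓ) hqual]

/-! ### The sample complexity -/

theorem le_sampleComplexity {τ ℓ : ℕ} {ε θm θd : ℝ} {x : ENNReal}
    (h : ∀ n, Solvable τ ℓ n ε θm θd → x ≤ n) :
    x ≤ (sampleComplexity τ ℓ ε θm θd : ENNReal) := by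
  unfold sampleComplexity
  by_cases hne : ∃ n, Solvable τ ℓ n ε θm θd
  · have : Nonempty {n // Solvable τ ℓ n ε θm θd} := nonempty_subtype.2 hne
    rw [iInf_subtype']
    obtain ⟨⟨n, hn⟩, hmin⟩ := ciInf_mem fun n : {n // Solvable τ ℓ n ε θm θd} => ((n : ℕ) : ℕ∞)
    rw [← hmin]
    exact_mod_cast h n hn
  · push Not at hne
    simp [hne]

end CrowdClustering

open CrowdClustering in
theorem mainTheorem11 (τ : ℕ) (hτ : 2 ≤ τ) (ε : ℝ) (hε : 0 < ε) (hε' : ε ≤ 1 / 4) :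
    -- fixed qualities, many objects
    (∀ θm θd : ℝ, NonDegenerate τ θm θd →
      ∃ c : ℝ, 0 < c ∧ ∃ L : ℕ, ∀ ℓ : ℕ, L ≤ ℓ →
        ENNReal.ofReal (c * Real.log ℓ) ≤ (sampleComplexity τ ℓ ε θm θd : ENNReal)) ∧
    -- fixed number of objects
    (∀ ℓ : ℕ, 2 ≤ ℓ → ∃ c : ℝ, 0 < c ∧ ∀ θm θd : ℝ, 0 ≤ θm → 0 ≤ θd →
      (∃ R : WorkerPool τ ℓ, R.HasQuality θm θd) →
        ENNReal.ofReal c / ENNReal.ofReal (θm + θd ^ 2) ≤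
          (sampleComplexity τ ℓ ε θm θd : ENNReal)) ∧
    -- the quality pairs that are covered
    (∀ d : ℝ, d < 2 → ∃ m κ : ℝ, 0 < m ∧ 0 < κ ∧ ∀ θm θd : ℝ, 0 ≤ θm → θm ≤ m →
      0 ≤ θd → θd ≤ d → ∀ ℓ : ℕ, 2 ≤ ℓ →
        ∃ R : WorkerPool τ ℓ, R.HasQuality θm θd ∧ R.IsNoisy κ) := by
  refine ⟨fun θm θd ⟨κ, hκ, L, hL⟩ => ?_, fun ℓ hℓ => ?_, exists_noisy_pool hτ⟩
  · have hκ' : 0 < min κ (1 / 2) := lt_min hκ (by norm_num)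
    have hlog : 0 < Real.log (1 / min κ (1 / 2)) := Real.log_pos (by
      rw [lt_div_iff₀ hκ']
      linarith [min_le_right κ (1 / 2)])
    refine ⟨1 / (3 * Real.log (1 / min κ (1 / 2))), by positivity, max L 3, fun ℓ hℓ => ?_⟩
    obtain ⟨R, hq, hR⟩ := hL ℓ (le_of_max_le_left hℓ)
    refine le_sampleComplexity fun n hn => ?_
    rw [← ENNReal.ofReal_natCast]
    exact ENNReal.ofReal_le_ofReal
      (log_le_of_solvable (le_of_max_le_right hℓ) hε' hκ R hq hR hn)
  · obtain ⟨c, hc, h⟩ := exists_le_mul_of_solvable hτ hε' hℓ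
    refine ⟨c, hc, fun θm θd hm hd hR => le_sampleComplexity fun n hn => ?_⟩
    have hle := h θm θd hm hd hR n hn
    -- solvability forces the qualities not to vanish simultaneously
    have hv : 0 < θm + θd ^ 2 :=
      pos_of_mul_pos_right (hc.trans_le hle) (Nat.cast_nonneg n)
    rw [ENNReal.div_le_iff (by simpa using hv) ENNReal.ofReal_ne_top, ← ENNReal.ofReal_natCast,
      ← ENNReal.ofReal_mul (Nat.cast_nonneg n)]
    exact ENNReal.ofReal_le_ofReal hle
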